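/- Consider independent bond percolation on $\mathbb{Z}^d$ with parameter $p\in[0,1]$: each nearest-neighbour edge is independently open with probability $p$ and closed with probability $1-p$, and $\mathbb{P}_p$ is the resulting product measure. Open clusters are the connected components of the graph formed by the open edges. Let $X$ be the subgraph of the nearest-neighbour lattice $\mathbb{Z}^d$ obtained by removing all vertices that lie in infinite open clusters, together with all edges incident to them (all other lattice edges, open or closed, are kept). Call a vertex shielded if all edges incident to it are closed, and call an infinite self-avoiding nearest-neighbour path shielded if all of its vertices are shielded. Define \[ p_c(d)=\inf\{p\in[0,1]:\mathbb{P}_p(\text{there is an infinite open cluster})>0\}, \] \[ p_{\mathrm{shield}}(d)=\sup\{p\in[0,1]:\mathbb{P}_p(\text{there is an infinite shielded path})>0\}, \] \[ p_{\mathrm{fin}}(d)=\sup\{p\in[0,1]:\mathbb{P}_p(X\text{ has an infinite connected component})>0\}. \] Then for every $d\ge 10$, \[ p_c(d)<p_{\mathrm{shield}}(d)\le p_{\mathrm{fin}}(d). \] In particular, there is $p\in(p_c(d),1]$ such that $\mathbb{P}_p(X\text{ has an infinite connected component})>0$. -/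

import Mathlib

open MeasureTheory ProbabilityTheory

namespace Percolation

/-- The nearest-neighbour graph on `ℤ^d`: two vertices are adjacent when their `ℓ¹` distance
is one. -/
def lattice (d : ℕ) : SimpleGraph (Fin d → ℤ) where
  Adj x y := ∑ i, |x i - y i| = 1
  symm := ⟨fun x y h => by simpa only [abs_sub_comm] using h⟩
  loopless := ⟨fun x h => by simp at h⟩

/-- Configurations in `{0,1}^E`, with `E` the set of nearest-neighbour edges of `ℤ^d`; the edge `e`
is open in `ω` if `ω e = true` and closed if `ω e = false`. -/
abbrev Config (d : ℕ) : Type := (lattice d).edgeSet → Bool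

/-- The law `ℙ_p`: the edges are independent, each open with probability `p` and closed with
probability `1 - p`. -/
noncomputable def bondMeasure (d : ℕ) (p : unitInterval) : Measure (Config d) :=
  Measure.infinitePi fun _ : (lattice d).edgeSet => bernoulliMeasure true false p

variable {d : ℕ}

/-- The graph on `ℤ^d` formed by the open edges; its connected components are the open clusters. -/
def openGraph (ω : Config d) : SimpleGraph (Fin d → ℤ) where
  Adj x y := ∃ h : (lattice d).Adj x y, ω ⟨s(x, y), h⟩ = true
  symm := ⟨by
    rintro x y ⟨h, hω⟩
    refine ⟨h.symm, ?_⟩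
    rw [← hω]
    exact congrArg ω (Subtype.ext Sym2.eq_swap)⟩
  loopless := ⟨fun x h => (lattice d).loopless.irrefl x h.1⟩

/-- A graph has an infinite connected component. -/
def HasInfiniteComponent {V : Type*} (G : SimpleGraph V) : Prop :=
  ∃ C : G.ConnectedComponent, C.supp.Infinite

/-- The open cluster of the vertex `x`. -/
def cluster (ω : Config d) (x : Fin d → ℤ) : Set (Fin d → ℤ) :=
  ((openGraph ω).connectedComponentMk x).supp

/-- What is left of `ℤ^d` after the vertices of infinite open clusters, and all edges incident
to them, have been removed. All other nearest-neighbour edges are kept, open or closed. -/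
def remainder (ω : Config d) : SimpleGraph {x | ¬ (cluster ω x).Infinite} :=
  (lattice d).induce {x | ¬ (cluster ω x).Infinite}

/-- A vertex is shielded if all edges incident to it are closed. -/
def Shielded (ω : Config d) (x : Fin d → ℤ) : Prop :=
  ∀ e : (lattice d).edgeSet, x ∈ (e : Sym2 (Fin d → ℤ)) → ω e = false

/-- There is an infinite (self-avoiding) nearest-neighbour path all of whose vertices are
shielded. -/
def HasInfiniteShieldedPath (ω : Config d) : Prop :=
  ∃ γ : ℕ → Fin d → ℤ, Function.Injective γ ∧
    (∀ n, (lattice d).Adj (γ n) (γ (n + 1))) ∧ ∀ n, Shielded ω (γ n)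

/-- The critical probability `p_c(d)`. -/
noncomputable def pCrit (d : ℕ) : ℝ :=
  sInf {p : ℝ | ∃ hp : p ∈ Set.Icc (0 : ℝ) 1,
    0 < bondMeasure d ⟨p, hp⟩ {ω | HasInfiniteComponent (openGraph ω)}}

/-- The complementary critical probability `p_fin(d)`. -/
noncomputable def pFin (d : ℕ) : ℝ :=
  sSup {p : ℝ | ∃ hp : p ∈ Set.Icc (0 : ℝ) 1,
    0 < bondMeasure d ⟨p, hp⟩ {ω | HasInfiniteComponent (remainder ω)}}

/-- The shielded critical probability `p_shield(d)`. -/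
noncomputable def pShield (d : ℕ) : ℝ :=
  sSup {p : ℝ | ∃ hp : p ∈ Set.Icc (0 : ℝ) 1,
    0 < bondMeasure d ⟨p, hp⟩ {ω | HasInfiniteShieldedPath ω}}

end Percolation

/-!
The proof compares two explicit densities: `pCrit d ≤ 1 / (d - 0.45)` and
`2 / (2 * d - 1) ≤ pShield d`. The first is smaller than the second. Both bounds come from the
second-moment method applied to oriented paths, that is, paths that only take steps `eₖ`.

Let `F s` be the set of edges that have to be in the prescribed state (open, or closed with
probability `q`) for the oriented path with steps `s` to be good. By the Cauchy-Schwarz inequality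
some path of length `n` is good with probability at least `1 / M`, as soon as the mean of
`q⁻¹ ^ #(F s ∩ F t)` over all pairs of words `s, t` of length `n` is at most `M`
(`one_le_mul_measureReal_exists_allState`). A bound uniform in `n` gives arbitrarily long good paths
with positive probability (`measure_frequently_pos`).

The exponent `#(F s ∩ F t)` is at most a sum over steps of a function of the current difference of
the two paths and of the two next steps (`pow_card_inter_pathEdges_le`,
`pow_card_inter_shieldEdges_le`). Hence it suffices to exhibit a positive function of the difference
that is superharmonic for the correspondingly weighted difference walk (`sum_pairWeight_le`). It is
built from the Green function `green` of the difference of two independent uniform oriented walks,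
which is harmonic except at the origin (`green_eq`).

* For open paths, `1 + c * green` works when `green 0` is not much larger than `1 + 1 / d`. The
  point probabilities of the oriented walk are multinomial, which gives `green 0 ≤ 1 + 1.43 / d`
  (`green_le`).
* For shielded paths a coincidence costs up to `2 * d` edges, each with a factor
  `1 / (1 - p)`. It is enough to use steps in the first ten coordinates: at `p = 2 / (2 * d - 1)`
  the cost `(1 - p) ^ (-(2 * d - 1))` decreases with `d` (`one_div_pow_le`), so only `d = 10`
  has to be computed, and there `green 0 ≤ 1.13305` (`green_ten_le`) is sufficient
  (`exists_shieldPotential`). Edges that join the two paths without being incident to a common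
  vertex occur only at differences `eᵢ - eⱼ`; lowering the Green function at the origin
  compensates for them.

Finally, the vertices of a shielded path are isolated in the open graph, so the path survives in
`remainder`.
-/

namespace Percolation

/-! ### Green function of the difference of two oriented walks -/

section Green

/-- Average over the backward unit steps: `avgSub f x = r⁻¹ ∑ₖ f (x - eₖ)`. -/
noncomputable def avgSub {r : ℕ} (f : (Fin r → ℤ) → ℝ) (x : Fin r → ℤ) : ℝ :=
  (∑ k, f (x - Pi.single k 1)) / r

/-- Average over the forward unit steps: `avgAdd f x = r⁻¹ ∑ₖ f (x + eₖ)`. -/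
noncomputable def avgAdd {r : ℕ} (f : (Fin r → ℤ) → ℝ) (x : Fin r → ℤ) : ℝ :=
  (∑ k, f (x + Pi.single k 1)) / r

/-- The indicator function of the origin. -/
noncomputable def origin {r : ℕ} (x : Fin r → ℤ) : ℝ := if x = 0 then 1 else 0

/-- `meet n D` is the probability that two independent uniform oriented walks, started at
displacement `D` from each other, are at the same vertex after `n` steps. -/
noncomputable def meet {r : ℕ} (n : ℕ) : (Fin r → ℤ) → ℝ :=
  (avgAdd ∘ avgSub)^[n] origin

/-- `walk n x` is the probability that the uniform oriented walk from `0` is at `x` after `n`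
steps. -/
noncomputable def walk {r : ℕ} (n : ℕ) : (Fin r → ℤ) → ℝ := avgSub^[n] origin

variable {r : ℕ}

lemma avgAdd_avgSub_commute : Function.Commute (avgAdd (r := r)) avgSub := by
  intro f
  funext x
  simp only [avgAdd, avgSub, ← Finset.sum_div]
  rw [Finset.sum_comm]
  simp only [add_sub_right_comm]

lemma meet_succ (n : ℕ) (D : Fin r → ℤ) :
    meet (n + 1) D
      = (∑ k, ∑ l, meet n (D + Pi.single k 1 - Pi.single l 1)) / (r : ℝ) ^ 2 := by
  rw [meet, Function.iterate_succ_apply']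
  simp only [Function.comp_apply, avgAdd, avgSub, ← Finset.sum_div, div_div, sq]
  rfl

lemma origin_nonneg (x : Fin r → ℤ) : 0 ≤ origin x := by
  unfold origin; split_ifs <;> norm_num

lemma meet_nonneg (n : ℕ) (D : Fin r → ℤ) : 0 ≤ meet n D := by
  induction n generalizing D with
  | zero => exact origin_nonneg D
  | succ n ih =>
    rw [meet_succ]
    exact div_nonneg (Finset.sum_nonneg fun k _ => Finset.sum_nonneg fun l _ => ih _)
      (by positivity)

lemma div_le_of_forall_le {C : ℝ} (hC : 0 ≤ C) {g : Fin r → ℝ} (hg : ∀ k, g k ≤ C) :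
    (∑ k, g k) / r ≤ C := by
  rcases Nat.eq_zero_or_pos r with h | h
  · subst h; simpa using hC
  · rw [div_le_iff₀ (by exact_mod_cast h)]
    calc ∑ k, g k ≤ ∑ _k : Fin r, C := Finset.sum_le_sum fun k _ => hg k
      _ = C * r := by simp [mul_comm]

lemma walk_add_le {C : ℝ} (hC : 0 ≤ C) {n : ℕ} (h : ∀ x : Fin r → ℤ, walk n x ≤ C) (i : ℕ)
    (x : Fin r → ℤ) : walk (n + i) x ≤ C := by
  induction i generalizing x with
  | zero => exact h x
  | succ i ih =>
    rw [← add_assoc, walk, Function.iterate_succ_apply']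
    exact div_le_of_forall_le hC fun k => ih _

/-- The meeting probability is at most the largest point probability of a single walk, since the
second walk may be fixed first. -/
lemma meet_le_of_walk_le {C : ℝ} (hC : 0 ≤ C) {n : ℕ} (h : ∀ x : Fin r → ℤ, walk n x ≤ C)
    (D : Fin r → ℤ) : meet n D ≤ C := by
  rw [meet, avgAdd_avgSub_commute.comp_iterate]
  have : ∀ m (x : Fin r → ℤ), avgAdd^[m] (walk n) x ≤ C := by
    intro m
    induction m with
    | zero => exact h
    | succ m ih =>
      intro x
      rw [Function.iterate_succ_apply']
      exact div_le_of_forall_le hC fun k => ih _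
  exact this n D

/-- The reciprocal factorial, extended by zero to the negative integers. -/
noncomputable def invFactorial (z : ℤ) : ℝ := if 0 ≤ z then 1 / (z.toNat.factorial : ℝ) else 0

lemma invFactorial_nonneg (z : ℤ) : 0 ≤ invFactorial z := by
  unfold invFactorial; split_ifs <;> positivity

lemma invFactorial_sub_one (z : ℤ) : invFactorial (z - 1) = z * invFactorial z := by
  unfold invFactorial
  rcases lt_trichotomy z 0 with h | h | h
  · rw [if_neg (by omega), if_neg (by omega), mul_zero]
  · subst h; simp
  · obtain ⟨n, rfl⟩ : ∃ n : ℕ, z = n + 1 := ⟨(z - 1).toNat, by omega⟩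
    rw [if_pos (by omega), if_pos (by omega)]
    have h1 : ((n : ℤ) + 1 - 1).toNat = n := by omega
    have h2 : ((n : ℤ) + 1).toNat = n + 1 := by omega
    rw [h1, h2, Nat.factorial_succ]
    have : (n.factorial : ℝ) ≠ 0 := by positivity
    push_cast
    field_simp

lemma factorial_add_le (z m : ℕ) : (z + m).factorial ≤ z.factorial * (z + m) ^ m := by
  induction m with
  | zero => simp
  | succ m ih =>
    rw [← add_assoc, Nat.factorial_succ, pow_succ]
    calc (z + m + 1) * (z + m).factorial ≤ (z + m + 1) * (z.factorial * (z + m) ^ m) := by gcongr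
      _ ≤ (z + m + 1) * (z.factorial * (z + m + 1) ^ m) := by
          gcongr (z + m + 1) * (z.factorial * ?_ ^ m)
          omega
      _ = _ := by ring

/-- Since `z! ≥ k! (k + 1) ^ (z - k)`, reciprocal factorials are dominated by a geometric
sequence that agrees with them at `k`. -/
lemma invFactorial_le (k : ℕ) (z : ℤ) :
    invFactorial z ≤ ((k : ℝ) + 1) ^ ((k : ℤ) - z) / k.factorial := by
  unfold invFactorial
  split_ifs with h
  swap
  · positivity
  lift z to ℕ using h
  rw [Int.toNat_natCast, div_le_div_iff₀ (by positivity) (by positivity), one_mul]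
  rcases le_total k z with hkz | hkz
  · obtain ⟨m, rfl⟩ := Nat.exists_eq_add_of_le hkz
    have : ((k : ℤ) - ((k + m : ℕ) : ℤ)) = -(m : ℤ) := by push_cast; ring
    rw [this, zpow_neg, zpow_natCast, inv_mul_eq_div, le_div_iff₀ (by positivity)]
    exact_mod_cast Nat.factorial_mul_pow_le_factorial (m := k) (n := m)
  · obtain ⟨m, rfl⟩ := Nat.exists_eq_add_of_le hkz
    have : (((z + m : ℕ) : ℤ) - (z : ℤ)) = (m : ℤ) := by push_cast; ring
    rw [this, zpow_natCast]
    have h1 := factorial_add_le z m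
    have h2 : z.factorial * (z + m) ^ m ≤ (z + m + 1) ^ m * z.factorial := by
      rw [mul_comm]
      gcongr ?_ ^ m * z.factorial
      omega
    exact_mod_cast h1.trans h2

lemma walk_eq_zero {n : ℕ} {x : Fin r → ℤ} (h : ∑ i, x i ≠ n) : walk n x = 0 := by
  induction n generalizing x with
  | zero =>
    have : x ≠ 0 := by rintro rfl; simp at h
    simp [walk, origin, this]
  | succ n ih =>
    rw [walk, Function.iterate_succ_apply']
    have : ∀ k, walk n (x - Pi.single k 1) = 0 := by
      intro k
      apply ih
      push_cast at h
      intro h'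
      apply h
      simp only [Pi.sub_apply, Finset.sum_sub_distrib, Finset.sum_pi_single', Finset.mem_univ,
        if_true] at h'
      omega
    exact (congrArg (· / (r : ℝ)) (Finset.sum_eq_zero fun k _ => this k)).trans (zero_div _)

lemma prod_invFactorial_sub_single (x : Fin r → ℤ) (k : Fin r) :
    ∏ i, invFactorial ((x - Pi.single k 1 : Fin r → ℤ) i) = x k * ∏ i, invFactorial (x i) := by
  rw [← Finset.mul_prod_erase _ _ (Finset.mem_univ k),
    ← Finset.mul_prod_erase _ (fun i => invFactorial (x i)) (Finset.mem_univ k)]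
  rw [Pi.sub_apply, Pi.single_eq_same, invFactorial_sub_one, mul_assoc]
  congr 2
  refine Finset.prod_congr rfl fun i hi => ?_
  simp [Pi.single_eq_of_ne (Finset.ne_of_mem_erase hi)]

lemma walk_le_multinomial (n : ℕ) (x : Fin r → ℤ) :
    walk n x ≤ n.factorial / (r : ℝ) ^ n * ∏ i, invFactorial (x i) := by
  induction n generalizing x with
  | zero =>
    by_cases h : x = 0
    · subst h; simp [walk, origin, invFactorial]
    · simp only [walk, Function.iterate_zero, id, origin, h, if_false]
      exact mul_nonneg (by positivity) (Finset.prod_nonneg fun i _ => invFactorial_nonneg _)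
  | succ n ih =>
    by_cases hx : ∑ i, x i = ((n + 1 : ℕ) : ℤ)
    swap
    · rw [walk_eq_zero hx]
      exact mul_nonneg (by positivity) (Finset.prod_nonneg fun i _ => invFactorial_nonneg _)
    rw [walk, Function.iterate_succ_apply']
    have hx' : ∑ i, (x i : ℝ) = n + 1 := by exact_mod_cast hx
    calc (∑ k, walk n (x - Pi.single k 1)) / (r : ℝ)
        ≤ (∑ k, n.factorial / (r : ℝ) ^ n * (x k * ∏ i, invFactorial (x i))) / r := by
          gcongr with k
          rw [← prod_invFactorial_sub_single]
          exact ih _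
      _ = _ := by
          rw [← Finset.mul_sum, ← Finset.sum_mul, hx', Nat.factorial_succ]
          push_cast
          rw [pow_succ, div_mul_eq_mul_div, div_mul_eq_mul_div, div_div]
          ring

/-- `peak r k j` bounds the point probabilities of the oriented walk in `r` dimensions after
`k * r + j` steps. -/
noncomputable def peak (r k j : ℕ) : ℝ :=
  (k * r + j).factorial / ((r : ℝ) ^ (k * r + j) * (k.factorial : ℝ) ^ r * ((k : ℝ) + 1) ^ j)

lemma peak_nonneg (r k j : ℕ) : 0 ≤ peak r k j := by unfold peak; positivity

lemma walk_le_peak (k j : ℕ) (x : Fin r → ℤ) : walk (k * r + j) x ≤ peak r k j := by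
  by_cases hx : ∑ i, x i = ((k * r + j : ℕ) : ℤ)
  swap
  · rw [walk_eq_zero hx]; exact peak_nonneg r k j
  refine (walk_le_multinomial _ x).trans ?_
  have h1 : ∏ i, invFactorial (x i)
      ≤ ∏ i : Fin r, ((k : ℝ) + 1) ^ ((k : ℤ) - x i) / k.factorial :=
    Finset.prod_le_prod (fun i _ => invFactorial_nonneg _) fun i _ => invFactorial_le k _
  have h2 : ∏ i : Fin r, ((k : ℝ) + 1) ^ ((k : ℤ) - x i) / k.factorial
      = ((k : ℝ) + 1) ^ (-(j : ℤ)) / (k.factorial : ℝ) ^ r := by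
    rw [Finset.prod_div_distrib, Finset.prod_const, Finset.card_univ, Fintype.card_fin]
    congr 1
    have hk : (k : ℝ) + 1 ≠ 0 := by positivity
    have hz : ∀ s : Finset (Fin r), ∏ i ∈ s, ((k : ℝ) + 1) ^ ((k : ℤ) - x i)
        = ((k : ℝ) + 1) ^ (∑ i ∈ s, ((k : ℤ) - x i)) := by
      intro s
      induction s using Finset.induction_on with
      | empty => simp
      | insert a s ha ih => rw [Finset.prod_insert ha, Finset.sum_insert ha, zpow_add₀ hk, ih]
    rw [hz, Finset.sum_sub_distrib, hx]
    congr 1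
    simp
    ring
  calc (k * r + j).factorial / (r : ℝ) ^ (k * r + j) * ∏ i, invFactorial (x i)
      ≤ (k * r + j).factorial / (r : ℝ) ^ (k * r + j)
          * (((k : ℝ) + 1) ^ (-(j : ℤ)) / (k.factorial : ℝ) ^ r) := by
        rw [← h2]; gcongr
    _ = peak r k j := by
        rw [peak, zpow_neg, zpow_natCast, inv_eq_one_div, div_div, div_mul_div_comm, mul_one]
        congr 1
        ring

lemma meet_le_peak (k j i : ℕ) (D : Fin r → ℤ) : meet (k * r + j + i) D ≤ peak r k j :=
  meet_le_of_walk_le (peak_nonneg r k j)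
    (walk_add_le (peak_nonneg r k j) (walk_le_peak k j) i) D

/-- The ratio `peak r (k+1) 0 / peak r k 0` is a product of `r` factors `1 - (r - j) / (r (k+1))`,
which decays like `exp (-(r-1) / (2 (k+1)))`. -/
lemma peak_succ_le (hr : 10 ≤ r) (k : ℕ) :
    ((k : ℝ) + 5) * peak r (k + 1) 0 ≤ (k + 1) * peak r k 0 := by
  have hr0 : (0 : ℝ) < r := by exact_mod_cast (by omega : 0 < r)
  have hr' : (10 : ℝ) ≤ r := by exact_mod_cast hr
  have hasc : ∀ j : ℕ, ((k * r + j).factorial : ℝ)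
      = (k * r).factorial * ∏ i ∈ Finset.range j, ((k : ℝ) * r + (i + 1)) := by
    intro j
    induction j with
    | zero => simp
    | succ j ih =>
      rw [← add_assoc, Nat.factorial_succ, Finset.prod_range_succ]
      push_cast
      rw [ih]
      ring
  have hprod : ∏ i ∈ Finset.range r, ((k : ℝ) * r + (i + 1))
      ≤ (((k : ℝ) + 1) * r) ^ r * Real.exp (-((r - 1) / (2 * (k + 1)))) := by
    have h1 : ∀ i ∈ Finset.range r, ((k : ℝ) * r + (i + 1))
        ≤ (((k : ℝ) + 1) * r) * Real.exp (-((r - 1 - i) / (r * (k + 1)))) := by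
      intro i _
      have h2 := Real.one_sub_le_exp_neg ((r - 1 - i) / (r * ((k : ℝ) + 1)))
      calc ((k : ℝ) * r + (i + 1))
          = (((k : ℝ) + 1) * r) * (1 - (r - 1 - i) / (r * ((k : ℝ) + 1))) := by
            field_simp; ring
        _ ≤ _ := by gcongr
    refine (Finset.prod_le_prod (fun i _ => by positivity) h1).trans (le_of_eq ?_)
    rw [Finset.prod_mul_distrib, Finset.prod_const, Finset.card_range, ← Real.exp_sum]
    congr 2
    rw [Finset.sum_neg_distrib, ← Finset.sum_div]
    congr 1
    have : ∀ n : ℕ, ∑ i ∈ Finset.range n, ((r : ℝ) - 1 - i) = n * (r - 1) - n * (n - 1) / 2 := by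
      intro n
      induction n with
      | zero => simp
      | succ n ih => rw [Finset.sum_range_succ, ih]; push_cast; ring
    rw [this]
    field_simp
    ring
  have hexp : Real.exp (-((r - 1) / (2 * ((k : ℝ) + 1)))) ≤ (k + 1) / (k + 5) := by
    rw [Real.exp_neg, inv_le_comm₀ (Real.exp_pos _) (by positivity), inv_div]
    refine le_trans ?_ (Real.add_one_le_exp _)
    rw [div_le_iff₀ (by positivity)]
    have : ((r : ℝ) - 1) / (2 * ((k : ℝ) + 1)) * (k + 1) = (r - 1) / 2 := by field_simp
    nlinarith
  have hpk : peak r (k + 1) 0 = peak r k 0 *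
      ((∏ i ∈ Finset.range r, ((k : ℝ) * r + (i + 1))) / (((k : ℝ) + 1) * r) ^ r) := by
    have h1 : (k + 1) * r = k * r + r := by ring
    simp only [peak, add_zero, pow_zero, mul_one]
    rw [h1, hasc r, Nat.factorial_succ, pow_add, div_mul_div_comm, mul_pow]
    push_cast
    rw [mul_pow]
    congr 1
    ring
  have hle : (∏ i ∈ Finset.range r, ((k : ℝ) * r + (i + 1))) / (((k : ℝ) + 1) * r) ^ r
      ≤ (k + 1) / (k + 5) := by
    rw [div_le_iff₀ (by positivity), mul_comm ((k + 1 : ℝ) / (k + 5))]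
    exact hprod.trans (by gcongr)
  calc ((k : ℝ) + 5) * peak r (k + 1) 0
      ≤ ((k : ℝ) + 5) * (peak r k 0 * ((k + 1) / (k + 5))) := by
        rw [hpk]; gcongr; exact peak_nonneg r k 0
    _ = _ := by field_simp

/-- Telescoping bound for the tail of the Green function, summed in blocks of length `r`. -/
lemma sum_meet_blocks_le (hr : 10 ≤ r) (K m : ℕ) (D : Fin r → ℤ) :
    ∑ n ∈ Finset.range ((K + m) * r), meet n D
      ≤ ∑ n ∈ Finset.range (K * r), meet n D
        + r * (((K : ℝ) + 4) / 3 * peak r K 0 - ((K : ℝ) + m + 4) / 3 * peak r (K + m) 0) := by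
  induction m with
  | zero => simp
  | succ m ih =>
    have h1 : (K + (m + 1)) * r = (K + m) * r + r := by ring
    rw [h1, Finset.sum_range_add]
    have h2 : ∑ i ∈ Finset.range r, meet ((K + m) * r + i) D ≤ r * peak r (K + m) 0 := by
      calc ∑ i ∈ Finset.range r, meet ((K + m) * r + i) D
          ≤ ∑ _i ∈ Finset.range r, peak r (K + m) 0 :=
            Finset.sum_le_sum fun i _ => meet_le_peak (K + m) 0 i D
        _ = _ := by simp
    have h3 := peak_succ_le hr (K + m)
    push_cast at h3 ⊢
    have h4 : (0 : ℝ) ≤ r := by positivity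
    rw [← add_assoc K m 1]
    nlinarith [mul_le_mul_of_nonneg_left h3 h4]

lemma sum_meet_le (hr : 10 ≤ r) (K N : ℕ) (D : Fin r → ℤ) :
    ∑ n ∈ Finset.range N, meet n D
      ≤ ∑ n ∈ Finset.range (K * r), meet n D + r * (((K : ℝ) + 4) / 3 * peak r K 0) := by
  have h1 : N ≤ (K + N) * r := by nlinarith
  refine (Finset.sum_le_sum_of_subset_of_nonneg (Finset.range_mono h1)
    fun n _ _ => meet_nonneg n D).trans ((sum_meet_blocks_le hr K N D).trans ?_)
  gcongr
  have := peak_nonneg r (K + N) 0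
  have : 0 ≤ ((K : ℝ) + N + 4) / 3 * peak r (K + N) 0 := by positivity
  linarith

lemma sum_meet_ten_le (N : ℕ) (D : Fin 10 → ℤ) :
    ∑ n ∈ Finset.range N, meet n D ≤ 1.13305 := by
  refine (sum_meet_le le_rfl 2 N D).trans ?_
  have h0 : ∀ j, meet (0 + j) D ≤ peak 10 0 j := fun j => by
    simpa using meet_le_peak (r := 10) 0 j 0 D
  have h1 : ∀ j, meet (10 + j) D ≤ peak 10 1 j := fun j => by
    simpa using meet_le_peak (r := 10) 1 j 0 D
  have h2 : ∑ n ∈ Finset.range (2 * 10), meet n D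
      ≤ ∑ j ∈ Finset.range 10, peak 10 0 j + ∑ j ∈ Finset.range 10, peak 10 1 j := by
    rw [show 2 * 10 = 10 + 10 from rfl, Finset.sum_range_add]
    gcongr with j _ j _
    · simpa using h0 j
    · exact h1 j
  refine (add_le_add_left h2 _).trans ?_
  norm_num [peak, Finset.sum_range_succ, Nat.factorial]

lemma factorial_div_pow_le (hr : 10 ≤ r) (n : ℕ) :
    (n + 1).factorial / (r : ℝ) ^ (n + 1) ≤ (n + 1).factorial / (r * 10 ^ n) := by
  have hr' : (10 : ℝ) ≤ r := by exact_mod_cast hr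
  rw [pow_succ']
  gcongr

lemma sum_meet_le_of_ten_le (hr : 10 ≤ r) (N : ℕ) (D : Fin r → ℤ) :
    ∑ n ∈ Finset.range N, meet n D ≤ 1 + 1.43 / r := by
  have hr' : (10 : ℝ) ≤ r := by exact_mod_cast hr
  have hr0 : (0 : ℝ) < r := by linarith
  refine (sum_meet_le hr 1 N D).trans ?_
  have h0 : ∀ j i, meet (j + i) D ≤ j.factorial / (r : ℝ) ^ j := fun j i => by
    simpa [peak] using meet_le_peak (r := r) 0 j i D
  have hten : (10 : ℕ).factorial / (r : ℝ) ^ 10 ≤ (10 : ℕ).factorial / (r ^ 2 * 10 ^ 8) := by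
    rw [show (10 : ℕ) = 2 + 8 from rfl, pow_add]
    gcongr
  have hpk : peak r 1 0 ≤ (10 : ℕ).factorial / (r ^ 2 * 10 ^ 8) := by
    refine le_trans ?_ hten
    obtain ⟨m, rfl⟩ := Nat.exists_eq_add_of_le hr
    simp only [peak, one_mul, add_zero, Nat.factorial_one, Nat.cast_one, one_pow, pow_zero,
      mul_one]
    rw [div_le_div_iff₀ (by positivity) (by positivity), pow_add]
    have : ((10 + m).factorial : ℝ) ≤ (10 : ℕ).factorial * ((10 + m : ℕ) : ℝ) ^ m := by
      exact_mod_cast factorial_add_le 10 m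
    calc ((10 + m).factorial : ℝ) * ((10 + m : ℕ) : ℝ) ^ 10
        ≤ ((10 : ℕ).factorial * ((10 + m : ℕ) : ℝ) ^ m) * ((10 + m : ℕ) : ℝ) ^ 10 := by gcongr
      _ = _ := by ring
  have h1 : ∑ n ∈ Finset.range (1 * r), meet n D
      ≤ ∑ n ∈ Finset.range 10, meet n D + r * ((10 : ℕ).factorial / (r ^ 2 * 10 ^ 8)) := by
    obtain ⟨m, hm⟩ := Nat.exists_eq_add_of_le hr
    rw [one_mul]
    nth_rewrite 1 [hm]
    rw [Finset.sum_range_add]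
    gcongr
    calc ∑ i ∈ Finset.range m, meet (10 + i) D
        ≤ ∑ _i ∈ Finset.range m, ((10 : ℕ).factorial / ((r : ℝ) ^ 2 * 10 ^ 8)) :=
          Finset.sum_le_sum fun i _ => (h0 10 i).trans hten
      _ = m * ((10 : ℕ).factorial / ((r : ℝ) ^ 2 * 10 ^ 8)) := by simp
      _ ≤ _ := by
          gcongr
          omega
  have h2 : ∑ n ∈ Finset.range 10, meet n D
      ≤ 1 + ∑ n ∈ Finset.range 9, (n + 1).factorial / ((r : ℝ) * 10 ^ n) := by
    rw [Finset.sum_range_succ', add_comm]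
    gcongr with n
    · simpa using h0 0 0
    · exact (h0 (n + 1) 0).trans (factorial_div_pow_le hr n)
  have h3 : ∑ n ∈ Finset.range 9, (n + 1).factorial / ((r : ℝ) * 10 ^ n)
      = (∑ n ∈ Finset.range 9, (n + 1).factorial / (10 : ℝ) ^ n) / r := by
    rw [Finset.sum_div]
    refine Finset.sum_congr rfl fun n _ => ?_
    rw [div_div, mul_comm]
  have h4 : ∑ n ∈ Finset.range 9, (n + 1).factorial / (10 : ℝ) ^ n ≤ 1.316 := by
    norm_num [Finset.sum_range_succ, Nat.factorial]
  have h5 : (r : ℝ) * ((10 : ℕ).factorial / (r ^ 2 * 10 ^ 8)) = 0.036288 / r := by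
    rw [show ((10 : ℕ).factorial : ℝ) = 3628800 by norm_num [Nat.factorial]]
    field_simp
    norm_num
  have h6 : (r : ℝ) * ((((1 : ℕ) : ℝ) + 4) / 3 * peak r 1 0) ≤ 5 / 3 * (0.036288 / r) := by
    rw [← h5]
    push_cast
    nlinarith [mul_le_mul_of_nonneg_left hpk hr0.le]
  have h7 : (∑ n ∈ Finset.range 9, (n + 1).factorial / (10 : ℝ) ^ n) / r ≤ 1.316 / r := by
    gcongr
  have h8 : 1 + 1.43 / r = 1 + 1.316 / r + (0.114 : ℝ) / r := by ring
  have h9 : 0.036288 / r + 5 / 3 * (0.036288 / r) ≤ (0.114 : ℝ) / r := by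
    rw [mul_div_assoc', ← add_div]
    gcongr
    norm_num
  linarith

/-- The Green function of the difference of two independent oriented walks: the expected number
of times at which they meet. -/
noncomputable def green (D : Fin r → ℤ) : ℝ := ∑' n, meet n D

lemma green_nonneg (D : Fin r → ℤ) : 0 ≤ green D := tsum_nonneg fun n => meet_nonneg n D

lemma summable_meet (hr : 10 ≤ r) (D : Fin r → ℤ) : Summable fun n => meet n D :=
  summable_of_sum_range_le (fun n => meet_nonneg n D) fun N => sum_meet_le_of_ten_le hr N D

lemma green_le (hr : 10 ≤ r) (D : Fin r → ℤ) : green D ≤ 1 + 1.43 / r :=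
  Real.tsum_le_of_sum_range_le (fun n => meet_nonneg n D) fun N => sum_meet_le_of_ten_le hr N D

lemma green_ten_le (D : Fin 10 → ℤ) : green D ≤ 1.13305 :=
  Real.tsum_le_of_sum_range_le (fun n => meet_nonneg n D) fun N => sum_meet_ten_le N D

lemma green_eq (hr : 10 ≤ r) (D : Fin r → ℤ) :
    green D
      = origin D + (∑ k, ∑ l, green (D + Pi.single k 1 - Pi.single l 1)) / (r : ℝ) ^ 2 := by
  rw [green, (summable_meet hr D).tsum_eq_zero_add]
  congr 1
  simp only [meet_succ, tsum_div_const]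
  congr 1
  rw [Summable.tsum_finsetSum fun k _ => summable_sum fun l _ => summable_meet hr _]
  refine Finset.sum_congr rfl fun k _ => ?_
  rw [Summable.tsum_finsetSum fun l _ => summable_meet hr _]
  rfl

lemma meet_comp_perm (σ : Equiv.Perm (Fin r)) (n : ℕ) (D : Fin r → ℤ) :
    meet n (D ∘ σ) = meet n D := by
  induction n generalizing D with
  | zero =>
    have : D ∘ σ = 0 ↔ D = 0 := by
      constructor
      · intro h
        funext i
        simpa using congrFun h (σ.symm i)
      · rintro rfl; rfl
    simp [meet, origin, this]
  | succ n ih =>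
    rw [meet_succ, meet_succ]
    congr 1
    rw [← Equiv.sum_comp σ.symm]
    refine Finset.sum_congr rfl fun k _ => ?_
    rw [← Equiv.sum_comp σ.symm]
    refine Finset.sum_congr rfl fun l _ => ?_
    rw [← ih (D + Pi.single k 1 - Pi.single l 1)]
    congr 1
    funext i
    simp [Pi.single_apply, Equiv.eq_symm_apply]

/-- Coordinate permutations act transitively on the differences `eᵢ - eⱼ` with `i ≠ j`. -/
lemma green_single_sub_single {i j i' j' : Fin r} (h : i ≠ j) (h' : i' ≠ j') :
    green (Pi.single i 1 - Pi.single j 1 : Fin r → ℤ)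
      = green (Pi.single i' 1 - Pi.single j' 1 : Fin r → ℤ) := by
  let σ : Equiv.Perm (Fin r) := Equiv.swap (Equiv.swap i i' j) j' * Equiv.swap i i'
  have hne : i' ≠ Equiv.swap i i' j := by
    intro hc
    apply h
    apply (Equiv.swap i i').injective
    rw [Equiv.swap_apply_left]
    exact hc
  have hi : σ i = i' := by
    simp only [σ, Equiv.Perm.mul_apply, Equiv.swap_apply_left]
    exact Equiv.swap_apply_of_ne_of_ne hne h'
  have hj : σ j = j' := by
    simp only [σ, Equiv.Perm.mul_apply, Equiv.swap_apply_left]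
  have hD : (Pi.single i 1 - Pi.single j 1 : Fin r → ℤ)
      = (Pi.single i' 1 - Pi.single j' 1 : Fin r → ℤ) ∘ σ := by
    funext m
    simp [Pi.single_apply, ← hi, ← hj]
  rw [hD]
  simp only [green, meet_comp_perm]

/-- The value of the Green function next to the origin, from the harmonicity equation at the
origin. -/
lemma green_single_sub_single_eq (hr : 10 ≤ r) {i j : Fin r} (h : i ≠ j) :
    (1 - 1 / (r : ℝ)) * green (Pi.single i 1 - Pi.single j 1 : Fin r → ℤ)
      = (1 - 1 / r) * green (0 : Fin r → ℤ) - 1 := by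
  have hr0 : (r : ℝ) ≠ 0 := by
    have : r ≠ 0 := by omega
    exact_mod_cast this
  have h0 := green_eq hr 0
  have h1 : ∀ k : Fin r, ∑ l, green (0 + Pi.single k 1 - Pi.single l 1 : Fin r → ℤ)
      = green (0 : Fin r → ℤ)
        + (r - 1) * green (Pi.single i 1 - Pi.single j 1 : Fin r → ℤ) := by
    intro k
    rw [← Finset.add_sum_erase _ _ (Finset.mem_univ k)]
    congr 1
    · simp
    · rw [Finset.sum_congr rfl fun l hl => by
        rw [zero_add, green_single_sub_single (Finset.ne_of_mem_erase hl).symm h]]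
      rw [Finset.sum_const, Finset.card_erase_of_mem (Finset.mem_univ k), Finset.card_univ,
        Fintype.card_fin, nsmul_eq_mul, Nat.cast_sub (by omega), Nat.cast_one]
  rw [Finset.sum_congr rfl fun k _ => h1 k] at h0
  simp only [origin, if_true, Finset.sum_const, Finset.card_univ, Fintype.card_fin,
    nsmul_eq_mul] at h0
  field_simp at h0 ⊢
  linarith

end Green

/-! ### The second-moment method for edge configurations -/

section SecondMoment

/-- Weighted second-moment inequality. If the normalised pair correlations
`μ (E s ∩ E t) / (μ (E s) μ (E t))` sum to at most `M * N ^ 2` over the `N ^ 2` pairs, then some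
event occurs with probability at least `1 / M`. -/
lemma one_le_mul_measureReal_iUnion {Ω σ : Type*} [MeasurableSpace Ω] [Fintype σ] [Nonempty σ]
    (μ : Measure Ω) [IsProbabilityMeasure μ] (E : σ → Set Ω) (hE : ∀ s, MeasurableSet (E s))
    (hpos : ∀ s, 0 < μ.real (E s)) (M : ℝ)
    (hM : ∑ s, ∑ t, μ.real (E s ∩ E t) / (μ.real (E s) * μ.real (E t))
      ≤ M * (Fintype.card σ : ℝ) ^ 2) :
    1 ≤ M * μ.real (⋃ s, E s) := by
  classical
  set N : ℝ := (Fintype.card σ : ℝ) with hN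
  have hN0 : 0 < N := by rw [hN]; exact_mod_cast Fintype.card_pos
  set U := ⋃ s, E s
  have hU : MeasurableSet U := MeasurableSet.iUnion hE
  set c : σ → ℝ := fun s => (μ.real (E s))⁻¹
  let Z : Ω → ℝ := fun ω => ∑ s, c s * (E s).indicator 1 ω
  let I : Ω → ℝ := U.indicator 1
  have hI2 : ∀ ω, I ω ^ 2 = I ω := by
    intro ω
    by_cases h : ω ∈ U <;> simp [I, h]
  have hZI : ∀ ω, Z ω * I ω = Z ω := by
    intro ω
    by_cases h : ω ∈ U
    · simp [I, h]
    · have : ∀ s, ω ∉ E s := fun s hs => h (Set.mem_iUnion.2 ⟨s, hs⟩)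
      simp [Z, this]
  have hind : ∀ S : Set Ω, MeasurableSet S → Integrable (S.indicator (1 : Ω → ℝ)) μ :=
    fun S hS => (integrable_const (1 : ℝ)).indicator hS
  have hZint : Integrable Z μ := integrable_finsetSum _ fun s _ => (hind _ (hE s)).const_mul _
  have hZ1 : ∫ ω, Z ω ∂μ = N := by
    simp only [Z]
    rw [integral_finsetSum _ fun s _ => (hind _ (hE s)).const_mul _]
    simp only [integral_const_mul, integral_indicator_one (hE _)]
    have : ∀ s, c s * μ.real (E s) = 1 := fun s => inv_mul_cancel₀ (hpos s).ne'
    simp [this, hN]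
  have hZsq : ∀ ω, Z ω ^ 2 = ∑ s, ∑ t, c s * c t * (E s ∩ E t).indicator 1 ω := by
    intro ω
    simp only [Z, sq, Finset.sum_mul_sum]
    refine Finset.sum_congr rfl fun s _ => Finset.sum_congr rfl fun t _ => ?_
    rw [Set.inter_indicator_one]
    simp only [Pi.mul_apply]
    ring
  have hterm : ∀ s t, Integrable (fun ω => c s * c t * (E s ∩ E t).indicator (1 : Ω → ℝ) ω) μ :=
    fun s t => (hind _ ((hE s).inter (hE t))).const_mul _
  have hZ2int : Integrable (fun ω => Z ω ^ 2) μ := by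
    simp only [hZsq]
    exact integrable_finsetSum _ fun s _ => integrable_finsetSum _ fun t _ => hterm s t
  have hZ2 : ∫ ω, Z ω ^ 2 ∂μ ≤ M * N ^ 2 := by
    simp only [hZsq]
    rw [integral_finsetSum _ fun s _ => integrable_finsetSum _ fun t _ => hterm s t]
    refine le_trans (le_of_eq ?_) hM
    refine Finset.sum_congr rfl fun s _ => ?_
    rw [integral_finsetSum _ fun t _ => hterm s t]
    refine Finset.sum_congr rfl fun t _ => ?_
    rw [integral_const_mul, integral_indicator_one ((hE s).inter (hE t)), div_eq_inv_mul,
      mul_inv]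
  -- The optimal multiple of the indicator in the Cauchy-Schwarz inequality is `M * N`.
  have hnn : 0 ≤ ∫ ω, (Z ω - M * N * I ω) ^ 2 ∂μ := integral_nonneg fun ω => sq_nonneg _
  have hexp : ∀ ω, (Z ω - M * N * I ω) ^ 2
      = Z ω ^ 2 - 2 * (M * N) * Z ω + (M * N) ^ 2 * I ω := by
    intro ω
    have h1 := hI2 ω
    have h2 := hZI ω
    calc (Z ω - M * N * I ω) ^ 2
        = Z ω ^ 2 - 2 * (M * N) * (Z ω * I ω) + (M * N) ^ 2 * I ω ^ 2 := by ring
      _ = _ := by rw [h1, h2]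
  simp only [hexp] at hnn
  have hsub : ∀ a : ℝ, Integrable (fun ω => Z ω ^ 2 - a * Z ω) μ :=
    fun a => hZ2int.sub (hZint.const_mul a)
  have hIint : Integrable I μ := hind U hU
  have hI1 : ∫ ω, I ω ∂μ = μ.real U := integral_indicator_one hU
  rw [integral_add (hsub _) (hIint.const_mul _),
    integral_sub hZ2int (hZint.const_mul _), integral_const_mul, integral_const_mul, hZ1,
    hI1] at hnn
  have hMpos : 0 < M := by
    have h1 : 0 < ∫ ω, Z ω ^ 2 ∂μ := by
      have h2 : 0 ≤ ∫ ω, (Z ω - N) ^ 2 ∂μ := integral_nonneg fun ω => sq_nonneg _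
      have h3 : ∀ ω, (Z ω - N) ^ 2 = Z ω ^ 2 - 2 * N * Z ω + N ^ 2 := fun ω => by ring
      simp only [h3] at h2
      rw [integral_add (hsub _) (integrable_const _),
        integral_sub hZ2int (hZint.const_mul _), integral_const_mul, hZ1] at h2
      simp at h2
      nlinarith
    by_contra hc
    have := h1.trans_le hZ2
    nlinarith [sq_nonneg N]
  have h5 : M * N ^ 2 * 1 ≤ M * N ^ 2 * (M * μ.real U) := by nlinarith
  exact le_of_mul_le_mul_left h5 (by positivity)

variable {d : ℕ}

/-- The event that all edges of `F` have state `b`. -/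
def allState (b : Bool) (F : Finset (lattice d).edgeSet) : Set (Config d) :=
  {ω | ∀ e ∈ F, ω e = b}

lemma allState_eq_pi (b : Bool) (F : Finset (lattice d).edgeSet) :
    allState b F = Set.pi F fun _ => {b} := by
  ext ω; simp [allState, Set.mem_pi]

lemma measurableSet_allState (b : Bool) (F : Finset (lattice d).edgeSet) :
    MeasurableSet (allState b F) := by
  rw [allState_eq_pi]
  exact MeasurableSet.pi F.countable_toSet fun _ _ => measurableSet_singleton b

instance (p : unitInterval) : IsProbabilityMeasure (bondMeasure d p) := by
  unfold bondMeasure; infer_instance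

/-- The probability that a given edge has state `b`. -/
def stateProb (p : unitInterval) (b : Bool) : ℝ := if b then p else 1 - p

lemma measureReal_allState (p : unitInterval) (b : Bool) (F : Finset (lattice d).edgeSet) :
    (bondMeasure d p).real (allState b F) = stateProb p b ^ F.card := by
  rw [allState_eq_pi, measureReal_def, bondMeasure,
    Measure.infinitePi_pi _ fun _ _ => measurableSet_singleton b, ENNReal.toReal_prod,
    Finset.prod_congr rfl fun e _ => (measureReal_def _ _).symm, Finset.prod_const]
  congr 1
  rw [bernoulliMeasure_real_apply p (measurableSet_singleton b)]
  cases b <;> simp [stateProb]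

/-- Second-moment criterion for a finite family of edge sets to contain one all of whose edges have
state `b`: only the sizes of the pairwise intersections matter. -/
lemma one_le_mul_measureReal_exists_allState [DecidableEq (lattice d).edgeSet] {σ : Type*}
    [Fintype σ] [Nonempty σ]
    (p : unitInterval) (b : Bool) (hq : 0 < stateProb p b)
    (F : σ → Finset (lattice d).edgeSet) (M : ℝ)
    (hM : ∑ s, ∑ t, (stateProb p b)⁻¹ ^ (F s ∩ F t).card ≤ M * (Fintype.card σ : ℝ) ^ 2) :
    1 ≤ M * (bondMeasure d p).real (⋃ s, allState b (F s)) := by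
  refine one_le_mul_measureReal_iUnion _ _ (fun s => measurableSet_allState b _) (fun s => ?_) M
    (le_trans (le_of_eq ?_) hM)
  · rw [measureReal_allState]; positivity
  · refine Finset.sum_congr rfl fun s _ => Finset.sum_congr rfl fun t _ => ?_
    have h1 : allState b (F s) ∩ allState b (F t) = allState b (F s ∪ F t) := by
      ext ω
      simp only [allState, Set.mem_inter_iff, Set.mem_ofPred_eq, Finset.mem_union]
      exact ⟨fun h e he => he.elim (h.1 e) (h.2 e), fun h =>
        ⟨fun e he => h e (Or.inl he), fun e he => h e (Or.inr he)⟩⟩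
    rw [h1, measureReal_allState, measureReal_allState, measureReal_allState, ← pow_add,
      ← Finset.card_union_add_card_inter, pow_add, inv_pow]
    field_simp

/-- If infinitely many events have probability at least `c > 0`, then with positive probability
infinitely many of them occur. -/
lemma measure_frequently_pos {Ω : Type*} [MeasurableSpace Ω] (μ : Measure Ω)
    [IsProbabilityMeasure μ] {A : ℕ → Set Ω} (hA : ∀ n, MeasurableSet (A n)) {M : ℝ}
    (h : ∀ n, 1 ≤ M * μ.real (A n)) : 0 < μ {ω | ∀ n, ∃ m ≥ n, ω ∈ A m} := by
  have hM : 0 < M := by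
    by_contra hc
    nlinarith [h 0, measureReal_nonneg (μ := μ) (s := A 0)]
  let B : ℕ → Set Ω := fun n => ⋃ m ≥ n, A m
  have hB : ∀ n, MeasurableSet (B n) := fun n =>
    MeasurableSet.iUnion fun m => MeasurableSet.iUnion fun _ => hA m
  have hanti : Antitone B := fun i j hij =>
    Set.biUnion_subset_biUnion_left fun m (hm : j ≤ m) => hij.trans hm
  have hBeq : {ω | ∀ n, ∃ m ≥ n, ω ∈ A m} = ⋂ n, B n := by
    ext ω; simp [B]
  have h1 := tendsto_measure_iInter_atTop (μ := μ) (fun n => (hB n).nullMeasurableSet) hanti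
    ⟨0, measure_ne_top _ _⟩
  have h2 : ENNReal.ofReal (1 / M) ≤ μ (⋂ n, B n) := by
    refine ge_of_tendsto' h1 fun n => ?_
    refine le_trans ?_ (measure_mono (Set.subset_biUnion_of_mem (u := A) (le_refl n)))
    rw [ENNReal.ofReal_le_iff_le_toReal (measure_ne_top _ _), div_le_iff₀ hM, mul_comm]
    exact h n
  rw [hBeq]
  exact (ENNReal.ofReal_pos.2 (by positivity)).trans_le h2

end SecondMoment

/-! ### Oriented open paths and the critical probability -/

section Bond

/-- Total weight picked up by a pair of words `s, t` of length `n` read from displacement `D`: a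
factor `W` for every pair of steps, and a factor `T` at the end. -/
def pairWeight {r : ℕ} (W : (Fin r → ℤ) → Fin r → Fin r → ℝ) (T : (Fin r → ℤ) → ℝ) :
    ∀ n : ℕ, (Fin r → ℤ) → (Fin n → Fin r) → (Fin n → Fin r) → ℝ
  | 0, D, _, _ => T D
  | n + 1, D, s, t => W D (s 0) (t 0) *
      pairWeight W T n (D + Pi.single (s 0) 1 - Pi.single (t 0) 1) (Fin.tail s) (Fin.tail t)

lemma sum_words_succ {r n : ℕ} (f : (Fin (n + 1) → Fin r) → ℝ) :
    ∑ s, f s = ∑ k, ∑ s : Fin n → Fin r, f (Fin.cons k s) := by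
  rw [← (Fin.consEquiv fun _ : Fin (n + 1) => Fin r).sum_comp, Fintype.sum_prod_type]
  rfl

/-- A function `h` that dominates the terminal weight and is superharmonic for the weighted
difference walk dominates the mean weight of all pairs of words. -/
lemma sum_pairWeight_le {r : ℕ} {W : (Fin r → ℤ) → Fin r → Fin r → ℝ} {T h : (Fin r → ℤ) → ℝ}
    (hW : ∀ D k l, 0 ≤ W D k l) (hT : ∀ D, T D ≤ h D)
    (hstep : ∀ D, ∑ k, ∑ l, W D k l * h (D + Pi.single k 1 - Pi.single l 1) ≤ (r : ℝ) ^ 2 * h D)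
    (n : ℕ) (D : Fin r → ℤ) :
    ∑ s, ∑ t, pairWeight W T n D s t ≤ ((r : ℝ) ^ n) ^ 2 * h D := by
  induction n generalizing D with
  | zero => simpa [pairWeight] using hT D
  | succ n ih =>
    calc ∑ s, ∑ t, pairWeight W T (n + 1) D s t
        = ∑ k, ∑ l, W D k l * ∑ s, ∑ t,
            pairWeight W T n (D + Pi.single k 1 - Pi.single l 1) s t := by
          rw [sum_words_succ]
          refine Finset.sum_congr rfl fun k _ => ?_
          simp only [sum_words_succ]
          rw [Finset.sum_comm]
          refine Finset.sum_congr rfl fun l _ => ?_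
          simp only [Finset.mul_sum]
          rfl
      _ ≤ ∑ k, ∑ l, W D k l * (((r : ℝ) ^ n) ^ 2 * h (D + Pi.single k 1 - Pi.single l 1)) := by
          gcongr with k _ l _
          · exact hW D k l
          · exact ih _
      _ = ((r : ℝ) ^ n) ^ 2
            * ∑ k, ∑ l, W D k l * h (D + Pi.single k 1 - Pi.single l 1) := by
          simp only [Finset.mul_sum]
          refine Finset.sum_congr rfl fun k _ => Finset.sum_congr rfl fun l _ => by ring
      _ ≤ ((r : ℝ) ^ n) ^ 2 * ((r : ℝ) ^ 2 * h D) := by gcongr; exact hstep D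
      _ = _ := by rw [pow_succ]; ring

variable {d : ℕ}

lemma lattice_adj_add_single (x : Fin d → ℤ) (k : Fin d) :
    (lattice d).Adj x (x + Pi.single k 1) := by
  change ∑ i, |x i - (x + Pi.single k 1 : Fin d → ℤ) i| = 1
  have : ∀ i, |x i - (x + Pi.single k 1 : Fin d → ℤ) i| = if i = k then 1 else 0 := by
    intro i
    by_cases h : i = k
    · subst h; simp
    · simp [h]
  rw [Finset.sum_congr rfl fun i _ => this i]
  simp

lemma lattice_adj_iff {x y : Fin d → ℤ} :
    (lattice d).Adj x y ↔ ∃ k, y = x + Pi.single k 1 ∨ x = y + Pi.single k 1 := by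
  constructor
  · intro h
    change ∑ i, |x i - y i| = 1 at h
    obtain ⟨k, -, hk⟩ := Finset.exists_ne_zero_of_sum_ne_zero (by rw [h]; norm_num)
    have hk1 : 1 ≤ |x k - y k| := Int.one_le_abs (by simpa [sub_eq_zero] using hk)
    rw [← Finset.add_sum_erase _ _ (Finset.mem_univ k)] at h
    have hnn : 0 ≤ ∑ i ∈ Finset.univ.erase k, |x i - y i| :=
      Finset.sum_nonneg fun i _ => abs_nonneg _
    have h0 : ∑ i ∈ Finset.univ.erase k, |x i - y i| = 0 := by omega
    have hk2 : |x k - y k| = 1 := by omega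
    have hi : ∀ i, i ≠ k → x i = y i := by
      intro i hik
      have := (Finset.sum_eq_zero_iff_of_nonneg fun i _ => abs_nonneg _).1 h0 i (by simp [hik])
      simpa [sub_eq_zero] using this
    refine ⟨k, ?_⟩
    rcases (abs_eq one_pos.le).1 hk2 with h1 | h1
    · right
      funext i
      by_cases hik : i = k
      · subst hik; simp; omega
      · simp [hik, hi i hik]
    · left
      funext i
      by_cases hik : i = k
      · subst hik; simp; omega
      · simp [hik, hi i hik]
  · rintro ⟨k, rfl | rfl⟩
    · exact lattice_adj_add_single x k
    · exact (lattice_adj_add_single y k).symm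

/-- The level of a vertex is the sum of its coordinates; it grows by one along oriented steps. -/
def level (x : Fin d → ℤ) : ℤ := ∑ i, x i

@[simp] lemma level_add_single (x : Fin d → ℤ) (k : Fin d) :
    level (x + Pi.single k 1) = level x + 1 := by
  simp [level, Finset.sum_add_distrib]

/-- The edge from `x` to `x + eₖ`. -/
def edge (x : Fin d → ℤ) (k : Fin d) : (lattice d).edgeSet :=
  ⟨s(x, x + Pi.single k 1), lattice_adj_add_single x k⟩

lemma mem_edge {x y : Fin d → ℤ} {k : Fin d} :
    y ∈ (edge x k : Sym2 (Fin d → ℤ)) ↔ y = x ∨ y = x + Pi.single k 1 := Sym2.mem_iff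

lemma edge_injective (x : Fin d → ℤ) : Function.Injective (edge x) := by
  intro k l h
  have h1 : x + Pi.single k 1 ∈ (edge x l : Sym2 (Fin d → ℤ)) := by
    rw [← h, mem_edge]; exact Or.inr rfl
  rw [mem_edge] at h1
  rcases h1 with h1 | h1
  · have := congrArg level h1
    simp at this
  · have := congrFun (add_left_cancel h1) k
    by_contra hkl
    simp [hkl] at this

open scoped Classical in
/-- The set of edges of the oriented path that starts at `x` and takes the steps `s`. -/
noncomputable def pathEdges : ∀ n : ℕ, (Fin d → ℤ) → (Fin n → Fin d) →
    Finset (lattice d).edgeSet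
  | 0, _, _ => ∅
  | n + 1, x, s => insert (edge x (s 0)) (pathEdges n (x + Pi.single (s 0) 1) (Fin.tail s))

lemma level_le_of_mem_pathEdges {n : ℕ} {x : Fin d → ℤ} {s : Fin n → Fin d}
    {e : (lattice d).edgeSet} (he : e ∈ pathEdges n x s) {y : Fin d → ℤ}
    (hy : y ∈ (e : Sym2 (Fin d → ℤ))) : level x ≤ level y := by
  induction n generalizing x with
  | zero => simp [pathEdges] at he
  | succ n ih =>
    rw [pathEdges, Finset.mem_insert] at he
    rcases he with rfl | he
    · rw [mem_edge] at hy
      rcases hy with rfl | rfl <;> simp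
    · have := ih he
      simp at this
      omega

lemma edge_notMem_pathEdges {n : ℕ} {x y : Fin d → ℤ} (h : level x < level y) (k : Fin d)
    (s : Fin n → Fin d) : edge x k ∉ pathEdges n y s := fun hm =>
  absurd (level_le_of_mem_pathEdges hm (mem_edge.2 (Or.inl rfl))) (not_le.2 h)

open scoped Classical in
/-- The pair weight of bond percolation: a factor `w` for every edge traversed by both paths. -/
noncomputable def bondWeight (w : ℝ) (D : Fin d → ℤ) (k l : Fin d) : ℝ :=
  if D = 0 ∧ k = l then w else 1

open scoped Classical in
lemma pow_card_inter_pathEdges_le {w : ℝ} (hw : 1 ≤ w) (n : ℕ) (x x' : Fin d → ℤ)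
    (hx : level x = level x') (s t : Fin n → Fin d) :
    w ^ (pathEdges n x s ∩ pathEdges n x' t).card
      ≤ pairWeight (bondWeight w) (fun _ => 1) n (x - x') s t := by
  induction n generalizing x x' with
  | zero => simp [pathEdges, pairWeight]
  | succ n ih =>
    have hw0 : 0 ≤ w := by linarith
    have h1 := ih (x + Pi.single (s 0) 1) (x' + Pi.single (t 0) 1) (by simp [hx]) (Fin.tail s)
      (Fin.tail t)
    have hD : x - x' + Pi.single (s 0) 1 - Pi.single (t 0) 1
        = x + Pi.single (s 0) 1 - (x' + Pi.single (t 0) 1) := by abel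
    rw [pairWeight, hD]
    simp only [pathEdges]
    set A := pathEdges n (x + Pi.single (s 0) 1) (Fin.tail s)
    set B := pathEdges n (x' + Pi.single (t 0) 1) (Fin.tail t)
    have hA : edge x' (t 0) ∉ A := edge_notMem_pathEdges (by simp [hx]) _ _
    have hB : edge x (s 0) ∉ B := edge_notMem_pathEdges (by simp [hx]) _ _
    by_cases h : x = x' ∧ s 0 = t 0
    · have hsub : insert (edge x (s 0)) A ∩ insert (edge x' (t 0)) B
          ⊆ insert (edge x (s 0)) (A ∩ B) := by
        rw [h.1, h.2, Finset.insert_inter_distrib]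
      calc w ^ (insert (edge x (s 0)) A ∩ insert (edge x' (t 0)) B).card
          ≤ w ^ ((A ∩ B).card + 1) :=
            pow_le_pow_right₀ hw ((Finset.card_le_card hsub).trans (Finset.card_insert_le _ _))
        _ = w * w ^ (A ∩ B).card := pow_succ' _ _
        _ ≤ _ := by
          rw [bondWeight, if_pos ⟨sub_eq_zero.2 h.1, h.2⟩]
          gcongr
    · have hne : edge x (s 0) ≠ edge x' (t 0) := by
        intro he
        apply h
        have hmem : x ∈ (edge x' (t 0) : Sym2 (Fin d → ℤ)) := by
          rw [← he, mem_edge]; exact Or.inl rfl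
        rw [mem_edge] at hmem
        rcases hmem with rfl | hmem
        · exact ⟨rfl, edge_injective _ he⟩
        · have := congrArg level hmem
          simp [hx] at this
      have hsub : insert (edge x (s 0)) A ∩ insert (edge x' (t 0)) B ⊆ A ∩ B := by
        intro e he
        simp only [Finset.mem_inter, Finset.mem_insert] at he ⊢
        rcases he with ⟨rfl | h1, h2 | h2⟩
        · exact absurd h2 hne
        · exact absurd h2 hB
        · exact absurd (h2 ▸ h1) hA
        · exact ⟨h1, h2⟩
      rw [bondWeight, if_neg (by rwa [sub_eq_zero]), one_mul]
      exact (pow_le_pow_right₀ hw (Finset.card_le_card hsub)).trans h1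

/-- Superharmonicity of `1 + c * green` for the bond pair weight: the gain `c` of the Green
function at the origin pays for the weight of an immediate coincidence. -/
lemma sum_bondWeight_mul_le (hd : 10 ≤ d) {w c : ℝ}
    (hwc : (w - 1) / d * (1 + c * green (0 : Fin d → ℤ)) ≤ c) (D : Fin d → ℤ) :
    ∑ k, ∑ l, bondWeight w D k l * (1 + c * green (D + Pi.single k 1 - Pi.single l 1))
      ≤ (d : ℝ) ^ 2 * (1 + c * green D) := by
  have hd0 : (0 : ℝ) < d := by exact_mod_cast (by omega : 0 < d)
  have hG : ∑ k, ∑ l, green (D + Pi.single k 1 - Pi.single l 1)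
      = (d : ℝ) ^ 2 * (green D - origin D) := by
    have h := green_eq hd D
    have h2 : green D - origin D
        = (∑ k, ∑ l, green (D + Pi.single k 1 - Pi.single l 1)) / (d : ℝ) ^ 2 := by linarith
    rw [h2]
    field_simp
  have hterm : ∀ k l, bondWeight w D k l * (1 + c * green (D + Pi.single k 1 - Pi.single l 1))
      = 1 + c * green (D + Pi.single k 1 - Pi.single l 1)
        + if k = l then (w - 1) * (origin D * (1 + c * green (0 : Fin d → ℤ))) else 0 := by
    intro k l
    by_cases hD : D = 0
    · subst hD
      by_cases hkl : k = l
      · subst hkl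
        simp [bondWeight, origin]
        ring
      · simp [bondWeight, hkl]
    · simp [bondWeight, hD, origin]
  simp only [hterm, Finset.sum_add_distrib, ← Finset.mul_sum, hG]
  simp only [Finset.sum_ite_eq, Finset.mem_univ, if_true, Finset.sum_const, Finset.card_univ,
    Fintype.card_fin, nsmul_eq_mul]
  have h1 : (d : ℝ) * ((w - 1) * (origin D * (1 + c * green (0 : Fin d → ℤ))))
      ≤ (d : ℝ) ^ 2 * (c * origin D) := by
    have h2 := mul_le_mul_of_nonneg_left hwc (mul_nonneg (sq_nonneg (d : ℝ)) (origin_nonneg D))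
    calc _ = (d : ℝ) ^ 2 * origin D * ((w - 1) / d * (1 + c * green (0 : Fin d → ℤ))) := by
          field_simp
      _ ≤ _ := h2
      _ = _ := by ring
  nlinarith

lemma exists_reachable_of_pathEdges {ω : Config d} {n : ℕ} {x : Fin d → ℤ} {s : Fin n → Fin d}
    (h : ω ∈ allState true (pathEdges n x s)) :
    ∃ y, (openGraph ω).Reachable x y ∧ level y = level x + n := by
  induction n generalizing x with
  | zero => exact ⟨x, SimpleGraph.Reachable.refl x, by simp⟩
  | succ n ih =>
    obtain ⟨y, hy, hl⟩ := ih (x := x + Pi.single (s 0) 1) (s := Fin.tail s)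
      (fun e he => h e (by rw [pathEdges]; exact Finset.mem_insert_of_mem he))
    refine ⟨y, SimpleGraph.Reachable.trans (SimpleGraph.Adj.reachable ?_) hy, ?_⟩
    · exact ⟨lattice_adj_add_single x (s 0), h (edge x (s 0))
        (by rw [pathEdges]; exact Finset.mem_insert_self _ _)⟩
    · rw [hl, level_add_single]; push_cast; ring

lemma hasInfiniteComponent_of_forall_level {ω : Config d}
    (h : ∀ N : ℕ, ∃ n ≥ N, ∃ y, (openGraph ω).Reachable 0 y ∧ level y = n) :
    HasInfiniteComponent (openGraph ω) := by
  refine ⟨(openGraph ω).connectedComponentMk 0, fun hfin => ?_⟩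
  obtain ⟨b, hb⟩ := (hfin.image level).bddAbove
  obtain ⟨n, hn, y, hy, hl⟩ := h (b.toNat + 1)
  have hy' : y ∈ ((openGraph ω).connectedComponentMk 0).supp := by
    rw [SimpleGraph.ConnectedComponent.mem_supp_iff, SimpleGraph.ConnectedComponent.eq]
    exact hy.symm
  have := hb (Set.mem_image_of_mem level hy')
  omega

lemma bondMeasure_hasInfiniteComponent_pos (hd : 10 ≤ d) {p : unitInterval}
    (hp : (p : ℝ) = 1 / (d - 0.45)) :
    0 < bondMeasure d p {ω | HasInfiniteComponent (openGraph ω)} := by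
  classical
  have hd' : (10 : ℝ) ≤ d := by exact_mod_cast hd
  have hd0 : (0 : ℝ) < d := by linarith
  have : Nonempty (Fin d) := ⟨⟨0, by omega⟩⟩
  set θ : ℝ := (d - 1.45) / d with hθ
  set Γ : ℝ := green (0 : Fin d → ℤ) with hΓ
  have hθ0 : 0 ≤ θ := div_nonneg (by linarith) hd0.le
  have hΓθ : θ * Γ < 1 := by
    have h1 : θ * Γ ≤ θ * (1 + 1.43 / d) := by gcongr; exact green_le hd 0
    refine h1.trans_lt ?_
    rw [hθ, div_mul_eq_mul_div, div_lt_one hd0]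
    have : ((d : ℝ) - 1.45) * (1 + 1.43 / d) = d - 0.02 - 1.45 * 1.43 / d := by
      field_simp; ring
    rw [this]
    have : (0 : ℝ) < 1.45 * 1.43 / d := by positivity
    linarith
  -- `c` solves `θ * (1 + c * Γ) = c`.
  set c : ℝ := θ / (1 - θ * Γ) with hc
  have hc0 : 0 ≤ c := div_nonneg hθ0 (by linarith)
  have hceq : θ * (1 + c * Γ) = c := by
    have : (1 - θ * Γ) ≠ 0 := by linarith
    rw [hc]; field_simp; ring
  set w : ℝ := d - 0.45 with hw
  have hq : stateProb p true = 1 / w := by simp [stateProb, hp]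
  have hw1 : 1 ≤ w := by linarith
  have hwθ : (w - 1) / d = θ := by rw [hw, hθ]; congr 1; ring
  have hstep := sum_bondWeight_mul_le hd (w := w) (by rw [hwθ, hceq])
  have key : ∀ n : ℕ, 1 ≤ (1 + c * Γ) * (bondMeasure d p).real
      (⋃ s : Fin n → Fin d, allState true (pathEdges n 0 s)) := by
    intro n
    refine one_le_mul_measureReal_exists_allState p true (by rw [hq]; positivity) _ _ ?_
    rw [hq, one_div, inv_inv]
    calc ∑ s, ∑ t, w ^ (pathEdges n 0 s ∩ pathEdges n 0 t).card
        ≤ ∑ s, ∑ t, pairWeight (bondWeight w) (fun _ => 1) n (0 - 0 : Fin d → ℤ) s t :=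
          Finset.sum_le_sum fun s _ => Finset.sum_le_sum fun t _ =>
            pow_card_inter_pathEdges_le hw1 n 0 0 rfl s t
      _ ≤ ((d : ℝ) ^ n) ^ 2 * (1 + c * green (0 - 0 : Fin d → ℤ)) := by
          refine sum_pairWeight_le (h := fun D => 1 + c * green D) (fun D k l => ?_)
            (fun D => ?_) hstep n _
          · unfold bondWeight; split_ifs <;> linarith
          · have := mul_nonneg hc0 (green_nonneg D)
            linarith
      _ = _ := by
          rw [sub_zero, ← hΓ]
          simp [mul_comm]
  refine (measure_frequently_pos _ (fun n => MeasurableSet.iUnion fun s =>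
    measurableSet_allState true _) key).trans_le (measure_mono fun ω hω => ?_)
  refine hasInfiniteComponent_of_forall_level fun N => ?_
  obtain ⟨n, hn, hωn⟩ := hω N
  obtain ⟨s, hs⟩ := Set.mem_iUnion.1 hωn
  obtain ⟨y, hy, hl⟩ := exists_reachable_of_pathEdges hs
  exact ⟨n, hn, y, hy, by simpa [level] using hl⟩

/-- Upper bound for the critical probability of order `1 / d + O (1 / d ^ 2)`. -/
lemma pCrit_le (hd : 10 ≤ d) : pCrit d ≤ 1 / ((d : ℝ) - 0.45) := by
  have hd' : (10 : ℝ) ≤ d := by exact_mod_cast hd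
  have hp : 1 / ((d : ℝ) - 0.45) ∈ Set.Icc (0 : ℝ) 1 :=
    ⟨one_div_nonneg.2 (by linarith), (div_le_one (by linarith)).2 (by linarith)⟩
  exact csInf_le ⟨0, fun p hp => hp.1.1⟩ ⟨hp, bondMeasure_hasInfiniteComponent_pos hd rfl⟩

end Bond

/-! ### Edges seen by two oriented paths -/

section Overlap

variable {d : ℕ}

open scoped Classical in
/-- The set of the `2 * d` edges incident to `x`. -/
noncomputable def incident (x : Fin d → ℤ) : Finset (lattice d).edgeSet :=
  Finset.univ.image (edge x) ∪ Finset.univ.image fun k => edge (x - Pi.single k 1) k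

lemma mem_incident {x : Fin d → ℤ} {e : (lattice d).edgeSet} :
    e ∈ incident x ↔ x ∈ (e : Sym2 (Fin d → ℤ)) := by
  classical
  constructor
  · intro h
    simp only [incident, Finset.mem_union, Finset.mem_image, Finset.mem_univ, true_and] at h
    rcases h with ⟨k, rfl⟩ | ⟨k, rfl⟩ <;> simp [mem_edge]
  · intro h
    obtain ⟨y, hy⟩ := Sym2.mem_iff_exists.1 h
    have hadj : (lattice d).Adj x y := by
      rw [← SimpleGraph.mem_edgeSet, ← hy]; exact e.2
    obtain ⟨k, rfl | rfl⟩ := lattice_adj_iff.1 hadj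
    · exact Finset.mem_union_left _
        (Finset.mem_image.2 ⟨k, Finset.mem_univ _, Subtype.ext hy.symm⟩)
    · refine Finset.mem_union_right _
        (Finset.mem_image.2 ⟨k, Finset.mem_univ _, Subtype.ext ?_⟩)
      rw [hy, Sym2.eq_swap]
      simp [edge]

lemma card_incident_le (x : Fin d → ℤ) : (incident x).card ≤ 2 * d := by
  classical
  calc (incident x).card ≤ d + d := (Finset.card_union_le _ _).trans
        (add_le_add (Finset.card_image_le.trans (by simp)) (Finset.card_image_le.trans (by simp)))
    _ = 2 * d := by ring

lemma edge_mem_incident (x : Fin d → ℤ) (k : Fin d) : edge x k ∈ incident x :=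
  mem_incident.2 (mem_edge.2 (Or.inl rfl))

lemma edge_mem_incident_add (x : Fin d → ℤ) (k : Fin d) :
    edge x k ∈ incident (x + Pi.single k 1) :=
  mem_incident.2 (mem_edge.2 (Or.inr rfl))

lemma adj_of_mem_incident {x y : Fin d → ℤ} {e : (lattice d).edgeSet} (hx : e ∈ incident x)
    (hy : e ∈ incident y) (hxy : x ≠ y) :
    (lattice d).Adj x y ∧ (e : Sym2 (Fin d → ℤ)) = s(x, y) := by
  rw [mem_incident] at hx hy
  have h := (Sym2.mem_and_mem_iff hxy).1 ⟨hx, hy⟩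
  exact ⟨by rw [← SimpleGraph.mem_edgeSet, ← h]; exact e.2, h⟩

lemma level_of_adj {x y : Fin d → ℤ} (h : (lattice d).Adj x y) :
    level y = level x + 1 ∨ level x = level y + 1 := by
  obtain ⟨k, rfl | rfl⟩ := lattice_adj_iff.1 h <;> simp

lemma disjoint_incident {x y : Fin d → ℤ} (hl : level x = level y) (hxy : x ≠ y)
    {e : (lattice d).edgeSet} (hx : e ∈ incident x) (hy : e ∈ incident y) : False := by
  rcases level_of_adj (adj_of_mem_incident hx hy hxy).1 with h | h <;> omega

section Paths

variable {r : ℕ} (ι : Fin r → Fin d)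

open scoped Classical in
/-- The set of edges incident to the oriented path that starts at `x` and takes the steps
`ι ∘ s`. -/
noncomputable def shieldEdges : ∀ n : ℕ, (Fin d → ℤ) → (Fin n → Fin r) →
    Finset (lattice d).edgeSet
  | 0, x, _ => incident x
  | n + 1, x, s => incident x ∪ shieldEdges n (x + Pi.single (ι (s 0)) 1) (Fin.tail s)

lemma incident_subset_shieldEdges (n : ℕ) (x : Fin d → ℤ) (s : Fin n → Fin r) :
    incident x ⊆ shieldEdges ι n x s := by
  cases n with
  | zero => exact subset_rfl
  | succ n => exact Finset.subset_union_left

/-- A vertex below the starting level of the path can only be seen from the starting vertex. -/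
lemma mem_incident_of_mem_shieldEdges {n : ℕ} {x z : Fin d → ℤ} {s : Fin n → Fin r}
    {e : (lattice d).edgeSet} (he : e ∈ shieldEdges ι n x s) (hz : e ∈ incident z)
    (hl : level z < level x) : e ∈ incident x := by
  induction n generalizing x with
  | zero => exact he
  | succ n ih =>
    rw [shieldEdges, Finset.mem_union] at he
    rcases he with he | he
    · exact he
    · have h1 := ih he (by rw [level_add_single]; omega)
      have hne : z ≠ x + Pi.single (ι (s 0)) 1 := by
        rintro rfl
        rw [level_add_single] at hl
        omega
      rcases level_of_adj (adj_of_mem_incident hz h1 hne).1 with h | h <;>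
        · rw [level_add_single] at h
          omega

end Paths

open scoped Classical in
/-- The pair weight of shielded vertices. A common vertex costs `b`, or only `a` if the next vertex
is common as well, since the edge in between is then counted twice. Between two distinct vertices,
followed by two distinct vertices, each edge that joins one of the paths to the other costs `c`. -/
noncomputable def shieldWeight {r : ℕ} (a b c : ℝ) (D : Fin r → ℤ) (k l : Fin r) : ℝ :=
  if D = 0 then (if k = l then a else b)
  else if D + Pi.single k 1 - Pi.single l 1 = 0 then 1
  else (if ∃ j, D = Pi.single l 1 - Pi.single j 1 then c else 1) *
    (if ∃ j, D = Pi.single j 1 - Pi.single k 1 then c else 1)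

/-- `Agree ι x x' D` says that `x - x'` is the image of `D` under the coordinate embedding `ι`. -/
def Agree {r : ℕ} (ι : Fin r → Fin d) (x x' : Fin d → ℤ) (D : Fin r → ℤ) : Prop :=
  (∀ k, x (ι k) = x' (ι k) + D k) ∧ ∀ i, i ∉ Set.range ι → x i = x' i

section Agree

variable {r : ℕ} {ι : Fin r → Fin d} {x x' : Fin d → ℤ} {D : Fin r → ℤ}

lemma Agree.eq_iff (h : Agree ι x x' D) : x = x' ↔ D = 0 := by
  constructor
  · rintro rfl
    funext k
    have := h.1 k
    simp at this ⊢
    exact this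
  · rintro rfl
    funext i
    by_cases hi : i ∈ Set.range ι
    · obtain ⟨k, rfl⟩ := hi
      simpa using h.1 k
    · exact h.2 i hi

lemma Agree.symm (h : Agree ι x x' D) : Agree ι x' x (-D) :=
  ⟨fun k => by have := h.1 k; simp; omega, fun i hi => (h.2 i hi).symm⟩

lemma Agree.step (hι : Function.Injective ι) (h : Agree ι x x' D) (k l : Fin r) :
    Agree ι (x + Pi.single (ι k) 1) (x' + Pi.single (ι l) 1)
      (D + Pi.single k 1 - Pi.single l 1) := by
  refine ⟨fun m => ?_, fun i hi => ?_⟩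
  · have := h.1 m
    simp only [Pi.add_apply, Pi.sub_apply, Pi.single_apply, hι.eq_iff]
    omega
  · have hk : i ≠ ι k := fun hc => hi ⟨k, hc.symm⟩
    have hl : i ≠ ι l := fun hc => hi ⟨l, hc.symm⟩
    simp [hk, hl, h.2 i hi]

lemma Agree.exists_of_adj (hι : Function.Injective ι) (h : Agree ι x x' D)
    (hl : level x = level x') {l : Fin r} (hadj : (lattice d).Adj x (x' + Pi.single (ι l) 1)) :
    ∃ j, D = Pi.single l 1 - Pi.single j 1 := by
  obtain ⟨i, hi | hi⟩ := lattice_adj_iff.1 hadj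
  swap
  · have := congrArg level hi
    simp only [level_add_single] at this
    omega
  have hir : i ∈ Set.range ι := by
    by_contra hc
    have h1 := congrFun hi i
    have h2 : i ≠ ι l := fun hc' => hc ⟨l, hc'.symm⟩
    simp [h2, h.2 i hc] at h1
  obtain ⟨j, rfl⟩ := hir
  refine ⟨j, ?_⟩
  funext m
  have h1 := congrFun hi (ι m)
  have h2 := h.1 m
  simp only [Pi.add_apply, Pi.sub_apply, Pi.single_apply, hι.eq_iff] at h1 ⊢
  omega

end Agree

open scoped Classical in
lemma card_incident_inter_le {x y : Fin d → ℤ} (hxy : x ≠ y) :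
    (incident x ∩ incident y).card ≤ if (lattice d).Adj x y then 1 else 0 := by
  split_ifs with h
  · refine Finset.card_le_one.2 fun e he f hf => Subtype.ext ?_
    rw [Finset.mem_inter] at he hf
    rw [(adj_of_mem_incident he.1 he.2 hxy).2, (adj_of_mem_incident hf.1 hf.2 hxy).2]
  · refine le_of_eq (Finset.card_eq_zero.2 (Finset.eq_empty_of_forall_notMem fun e he => h ?_))
    rw [Finset.mem_inter] at he
    exact (adj_of_mem_incident he.1 he.2 hxy).1

lemma pow_le_mul_pow_of_le_add {w u : ℝ} (hw : 1 ≤ w) {m n j : ℕ} (h : m ≤ j + n)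
    (hu : w ^ j ≤ u) : w ^ m ≤ u * w ^ n := by
  have hw0 : 0 ≤ w := by linarith
  calc w ^ m ≤ w ^ (j + n) := pow_le_pow_right₀ hw h
    _ = w ^ j * w ^ n := pow_add _ _ _
    _ ≤ _ := by gcongr

open scoped Classical in
lemma pow_card_inter_shieldEdges_le {r : ℕ} {ι : Fin r → Fin d} (hι : Function.Injective ι)
    {w a b c : ℝ} (hw : 1 ≤ w) (ha : w ^ (2 * d - 1) ≤ a) (hb : w ^ (2 * d) ≤ b) (hc : w ≤ c)
    (n : ℕ) (x x' : Fin d → ℤ) (D : Fin r → ℤ) (hD : Agree ι x x' D)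
    (hx : level x = level x') (s t : Fin n → Fin r) :
    w ^ (shieldEdges ι n x s ∩ shieldEdges ι n x' t).card
      ≤ pairWeight (shieldWeight a b c) (fun D => if D = 0 then b else 1) n D s t := by
  have hw0 : 0 ≤ w := by linarith
  have hc1 : 1 ≤ c := hw.trans hc
  induction n generalizing x x' D with
  | zero =>
    simp only [shieldEdges, pairWeight]
    split_ifs with h
    · rw [← hD.eq_iff] at h
      subst h
      rw [Finset.inter_self]
      exact (pow_le_pow_right₀ hw (card_incident_le x)).trans hb
    · rw [← hD.eq_iff] at h
      rw [Finset.card_eq_zero.2, pow_zero]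
      refine Finset.eq_empty_of_forall_notMem fun e he => ?_
      rw [Finset.mem_inter] at he
      exact disjoint_incident hx h he.1 he.2
  | succ n ih =>
    have hD1 := hD.step hι (s 0) (t 0)
    have h1 := ih _ _ _ hD1 (by simp [hx]) (Fin.tail s) (Fin.tail t)
    rw [pairWeight]
    simp only [shieldEdges]
    set D₁ := D + Pi.single (s 0) 1 - Pi.single (t 0) 1 with hD₁
    have hAsub := incident_subset_shieldEdges ι n (x + Pi.single (ι (s 0)) 1) (Fin.tail s)
    have hBsub := incident_subset_shieldEdges ι n (x' + Pi.single (ι (t 0)) 1) (Fin.tail t)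
    have hAinc : ∀ {e}, e ∈ shieldEdges ι n (x + Pi.single (ι (s 0)) 1) (Fin.tail s) →
        e ∈ incident x' → e ∈ incident (x + Pi.single (ι (s 0)) 1) := fun he hz =>
      mem_incident_of_mem_shieldEdges ι he hz (by simp [hx])
    have hBinc : ∀ {e}, e ∈ shieldEdges ι n (x' + Pi.single (ι (t 0)) 1) (Fin.tail t) →
        e ∈ incident x → e ∈ incident (x' + Pi.single (ι (t 0)) 1) := fun he hz =>
      mem_incident_of_mem_shieldEdges ι he hz (by simp [hx])
    set A := shieldEdges ι n (x + Pi.single (ι (s 0)) 1) (Fin.tail s)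
    set B := shieldEdges ι n (x' + Pi.single (ι (t 0)) 1) (Fin.tail t)
    -- It suffices to cover the edges seen by both paths, other than those in `A ∩ B`, by `S`.
    have reduce : ∀ (S : Finset (lattice d).edgeSet) (u : ℝ),
        (incident x ∪ A) ∩ (incident x' ∪ B) ⊆ S ∪ (A ∩ B) → w ^ S.card ≤ u →
        w ^ ((incident x ∪ A) ∩ (incident x' ∪ B)).card ≤ u *
          pairWeight (shieldWeight a b c) (fun D => if D = 0 then b else 1) n D₁
            (Fin.tail s) (Fin.tail t) := by
      intro S u hS hu
      have h2 := pow_le_mul_pow_of_le_add hw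
        ((Finset.card_le_card hS).trans (Finset.card_union_le _ _)) hu
      have hu0 : 0 ≤ u := le_trans (by positivity) hu
      exact h2.trans (by gcongr)
    by_cases h0 : D = 0
    · have hxx : x = x' := hD.eq_iff.2 h0
      by_cases hst : s 0 = t 0
      · have hmem : edge x (ι (s 0)) ∈ A ∩ B := by
          refine Finset.mem_inter.2 ⟨hAsub (edge_mem_incident_add _ _), hBsub ?_⟩
          rw [← hxx, ← hst]
          exact edge_mem_incident_add _ _
        rw [shieldWeight, if_pos h0, if_pos hst]
        refine reduce ((incident x).erase (edge x (ι (s 0)))) a (fun e he => ?_) ?_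
        · simp only [Finset.mem_inter, Finset.mem_union, Finset.mem_erase] at he ⊢ hmem
          by_cases hee : e = edge x (ι (s 0))
          · right; rw [hee]; exact hmem
          · by_cases hex : e ∈ incident x
            · exact Or.inl ⟨hee, hex⟩
            · rw [← hxx] at he
              tauto
        · refine (pow_le_pow_right₀ hw ?_).trans ha
          rw [Finset.card_erase_of_mem (edge_mem_incident _ _)]
          have := card_incident_le x
          omega
      · rw [shieldWeight, if_pos h0, if_neg hst]
        refine reduce (incident x) b (fun e he => ?_)
          ((pow_le_pow_right₀ hw (card_incident_le x)).trans hb)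
        simp only [Finset.mem_inter, Finset.mem_union] at he ⊢
        rw [← hxx] at he
        tauto
    · have hne : x ≠ x' := fun h => h0 (hD.eq_iff.1 h)
      have hdis : ∀ {e}, e ∈ incident x → e ∈ incident x' → False :=
        fun he he' => disjoint_incident hx hne he he'
      by_cases h0' : D₁ = 0
      · have hxx : x + Pi.single (ι (s 0)) 1 = x' + Pi.single (ι (t 0)) 1 := hD1.eq_iff.2 h0'
        rw [shieldWeight, if_neg h0, if_pos h0']
        refine reduce ∅ 1 (fun e he => ?_) (by simp)
        simp only [Finset.mem_inter, Finset.mem_union, Finset.notMem_empty, false_or] at he ⊢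
        rcases he with ⟨h1 | h1, h2 | h2⟩
        · exact (hdis h1 h2).elim
        · exact ⟨hAsub (hxx ▸ hBinc h2 h1), h2⟩
        · exact ⟨h1, hBsub (hxx ▸ hAinc h1 h2)⟩
        · exact ⟨h1, h2⟩
      · rw [shieldWeight, if_neg h0, if_neg h0']
        have hn1 : x ≠ x' + Pi.single (ι (t 0)) 1 := by
          intro h
          have := congrArg level h
          simp [hx] at this
        have hn2 : x' ≠ x + Pi.single (ι (s 0)) 1 := by
          intro h
          have := congrArg level h
          simp [hx] at this
        have hbound : ∀ {y z : Fin d → ℤ} {P : Prop} [Decidable P], y ≠ z → ((lattice d).Adj y z → P) →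
            w ^ (incident y ∩ incident z).card ≤ if P then c else 1 := by
          intro y z P _ hyz hP
          have hcard := card_incident_inter_le hyz
          split_ifs with hPP
          · have : (incident y ∩ incident z).card ≤ 1 := hcard.trans (by split_ifs <;> simp)
            exact (pow_le_pow_right₀ hw this).trans (by simpa using hc)
          · rw [if_neg fun h => hPP (hP h)] at hcard
            rw [Nat.le_zero.1 hcard, pow_zero]
        refine reduce ((incident x ∩ incident (x' + Pi.single (ι (t 0)) 1)) ∪
          (incident x' ∩ incident (x + Pi.single (ι (s 0)) 1))) _ (fun e he => ?_) ?_
        · simp only [Finset.mem_inter, Finset.mem_union] at he ⊢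
          rcases he with ⟨h1 | h1, h2 | h2⟩
          · exact (hdis h1 h2).elim
          · exact Or.inl (Or.inl ⟨h1, hBinc h2 h1⟩)
          · exact Or.inl (Or.inr ⟨h2, hAinc h1 h2⟩)
          · exact Or.inr ⟨h1, h2⟩
        · refine (pow_le_pow_right₀ hw (Finset.card_union_le _ _)).trans ?_
          rw [pow_add]
          refine mul_le_mul (hbound hn1 (hD.exists_of_adj hι hx)) (hbound hn2 fun hadj => ?_)
            (by positivity) (by split_ifs <;> linarith)
          obtain ⟨j, hj⟩ := hD.symm.exists_of_adj hι hx.symm hadj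
          exact ⟨j, by rw [← neg_neg D, hj]; abel⟩

end Overlap

/-! ### A superharmonic function for shielded paths -/

section Potential

variable {d : ℕ}

/-- The superharmonic function used for shielded paths: a multiple of the Green function lowered
at the origin, so that its one-step average next to the origin leaves room for the weight of
edges that join the two paths. -/
noncomputable def shieldPotential (α κ : ℝ) (D : Fin 10 → ℤ) : ℝ :=
  1 + α * green D - κ * origin D

lemma single_sub_single_eq_iff {r : ℕ} {i j l m : Fin r} (h : i ≠ j) :
    (Pi.single i 1 - Pi.single j 1 : Fin r → ℤ) = Pi.single l 1 - Pi.single m 1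
      ↔ l = i ∧ m = j := by
  constructor
  · intro he
    have h1 := congrFun he i
    have h2 := congrFun he j
    simp only [Pi.sub_apply, Pi.single_apply, if_pos, h, h.symm, if_false] at h1 h2
    constructor
    · by_contra hc
      rw [if_neg (Ne.symm hc)] at h1
      split_ifs at h1 <;> omega
    · by_contra hc
      rw [if_neg (Ne.symm hc)] at h2
      split_ifs at h2 <;> omega
  · rintro ⟨rfl, rfl⟩; rfl

lemma single_sub_single_step_eq_zero_iff {r : ℕ} {i j k l : Fin r} (h : i ≠ j) :
    (Pi.single i 1 - Pi.single j 1 + Pi.single k 1 - Pi.single l 1 : Fin r → ℤ) = 0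
      ↔ l = i ∧ k = j := by
  rw [← single_sub_single_eq_iff h, sub_eq_zero, ← eq_sub_iff_add_eq]

lemma sum_origin_step {r : ℕ} {i j : Fin r} (h : i ≠ j) :
    ∑ k, ∑ l, origin (Pi.single i 1 - Pi.single j 1 + Pi.single k 1 - Pi.single l 1
      : Fin r → ℤ) = 1 := by
  simp [origin, single_sub_single_step_eq_zero_iff h, ite_and]

/-- One-step inequality for `shieldPotential`. Here `g` is the common value of `1 + α * green` at
the neighbours `eᵢ - eⱼ` of the origin, and `κ` pays for the at most `20` pairs of steps from there
that pick up a factor `c`. -/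
lemma sum_shieldWeight_mul_le {α κ a b c g : ℝ} (hc : 1 ≤ c) (hα : 0 ≤ α) (hκ : 0 ≤ κ)
    (hg : ∀ i j : Fin 10, i ≠ j → 1 + α * green (Pi.single i 1 - Pi.single j 1 : Fin 10 → ℤ) = g)
    (hκg : 20 * (c - 1) * g ≤ κ)
    (h0 : 10 * a * shieldPotential α κ 0 + 90 * b * g ≤ 100 * shieldPotential α κ 0)
    (D : Fin 10 → ℤ) :
    ∑ k, ∑ l, shieldWeight a b c D k l *
        shieldPotential α κ (D + Pi.single k 1 - Pi.single l 1)
      ≤ ((10 : ℕ) : ℝ) ^ 2 * shieldPotential α κ D := by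
  have hgpos : 0 ≤ g := by
    rw [← hg 0 1 (by decide)]
    have := mul_nonneg hα (green_nonneg (Pi.single 0 1 - Pi.single 1 1 : Fin 10 → ℤ))
    linarith
  by_cases hD : D = 0
  · subst hD
    have hterm : ∀ k l : Fin 10, shieldWeight a b c 0 k l *
        shieldPotential α κ (0 + Pi.single k 1 - Pi.single l 1)
        = if k = l then a * shieldPotential α κ 0 else b * g := by
      intro k l
      by_cases hkl : k = l
      · subst hkl; simp [shieldWeight]
      · have hne : (Pi.single k 1 - Pi.single l 1 : Fin 10 → ℤ) ≠ 0 := by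
          intro h
          have := congrFun h k
          simp [hkl] at this
        rw [zero_add, shieldWeight, if_pos rfl, if_neg hkl, if_neg hkl, shieldPotential, hg k l hkl]
        simp [origin, hne]
    have hsplit : ∀ k l : Fin 10, (if k = l then a * shieldPotential α κ 0 else b * g)
        = b * g + if k = l then a * shieldPotential α κ 0 - b * g else 0 := by
      intro k l; split_ifs <;> ring
    simp only [hterm, hsplit, Finset.sum_add_distrib]
    simp
    linarith
  · have hG : ∑ k, ∑ l, green (D + Pi.single k 1 - Pi.single l 1) = 100 * green D := by
      have h := green_eq le_rfl D
      simp only [origin, hD, if_false] at h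
      push_cast at h
      linarith
    have hsum : ∑ k, ∑ l, shieldPotential α κ (D + Pi.single k 1 - Pi.single l 1)
        = 100 * (1 + α * green D)
          - κ * ∑ k, ∑ l, origin (D + Pi.single k 1 - Pi.single l 1) := by
      simp only [shieldPotential, Finset.sum_sub_distrib, Finset.sum_add_distrib,
        ← Finset.mul_sum, hG]
      simp
      ring
    have hpot : shieldPotential α κ D = 1 + α * green D := by simp [shieldPotential, origin, hD]
    rw [hpot]
    by_cases hnear : ∃ i j, D = Pi.single i 1 - Pi.single j 1
    · obtain ⟨i, j, rfl⟩ := hnear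
      have hij : i ≠ j := by rintro rfl; simp at hD
      have hterm : ∀ k l : Fin 10, shieldWeight a b c (Pi.single i 1 - Pi.single j 1) k l *
          shieldPotential α κ (Pi.single i 1 - Pi.single j 1 + Pi.single k 1 - Pi.single l 1)
          ≤ shieldPotential α κ (Pi.single i 1 - Pi.single j 1 + Pi.single k 1 - Pi.single l 1)
            + ((if k = j then (c - 1) * g else 0) + if l = i then (c - 1) * g else 0) := by
        intro k l
        have hcg : 0 ≤ (c - 1) * g := mul_nonneg (by linarith) hgpos
        have hpos : 0 ≤ (if k = j then (c - 1) * g else 0)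
            + if l = i then (c - 1) * g else 0 := by split_ifs <;> linarith
        have hpotg : ∀ {m n : Fin 10}, m ≠ n →
            shieldPotential α κ (Pi.single m 1 - Pi.single n 1) = g := by
          intro m n hmn
          have hne : (Pi.single m 1 - Pi.single n 1 : Fin 10 → ℤ) ≠ 0 := by
            intro h
            have := congrFun h m
            simp [hmn] at this
          rw [← hg m n hmn]
          simp [shieldPotential, origin, hne]
        have hl : (∃ m, (Pi.single i 1 - Pi.single j 1 : Fin 10 → ℤ)
            = Pi.single l 1 - Pi.single m 1) ↔ l = i := by
          simp [single_sub_single_eq_iff hij]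
        have hk : (∃ m, (Pi.single i 1 - Pi.single j 1 : Fin 10 → ℤ)
            = Pi.single m 1 - Pi.single k 1) ↔ k = j := by
          simp [single_sub_single_eq_iff hij]
        rw [shieldWeight, if_neg hD]
        simp only [single_sub_single_step_eq_zero_iff hij, hl, hk]
        by_cases hli : l = i <;> by_cases hkj : k = j
        · rw [if_pos ⟨hli, hkj⟩, one_mul]
          linarith
        · subst hli
          have he : (Pi.single l 1 - Pi.single j 1 + Pi.single k 1 - Pi.single l 1 : Fin 10 → ℤ)
              = Pi.single k 1 - Pi.single j 1 := by abel
          rw [he, hpotg hkj]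
          simp [hkj]
          linarith
        · subst hkj
          have he : (Pi.single i 1 - Pi.single k 1 + Pi.single k 1 - Pi.single l 1 : Fin 10 → ℤ)
              = Pi.single i 1 - Pi.single l 1 := by abel
          rw [he, hpotg (Ne.symm hli)]
          simp [hli]
          linarith
        · simp [hli, hkj]
      refine (Finset.sum_le_sum fun k _ => Finset.sum_le_sum fun l _ => hterm k l).trans ?_
      simp only [Finset.sum_add_distrib]
      rw [hsum, sum_origin_step hij, hg i j hij]
      simp
      linarith
    · have hterm : ∀ k l : Fin 10, shieldWeight a b c D k l *
          shieldPotential α κ (D + Pi.single k 1 - Pi.single l 1)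
          = shieldPotential α κ (D + Pi.single k 1 - Pi.single l 1) := by
        intro k l
        have h1 : ¬ ∃ j, D = Pi.single l 1 - Pi.single j 1 := fun ⟨j, hj⟩ => hnear ⟨l, j, hj⟩
        have h2 : ¬ ∃ j, D = Pi.single j 1 - Pi.single k 1 := fun ⟨j, hj⟩ => hnear ⟨j, k, hj⟩
        rw [shieldWeight, if_neg hD, if_neg h1, if_neg h2]
        simp
      simp only [hterm]
      rw [hsum]
      have : 0 ≤ κ * ∑ k, ∑ l, origin (D + Pi.single k 1 - Pi.single l 1) :=
        mul_nonneg hκ (Finset.sum_nonneg fun k _ => Finset.sum_nonneg fun l _ => origin_nonneg _)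
      push_cast
      linarith

/-- Numerical core of the argument: with weights that come from the edge density `2 / 19` in
dimension ten, the bound on the ten-dimensional Green function is good enough for the potential to
be superharmonic. -/
lemma exists_shieldPotential :
    ∃ α κ : ℝ, (∀ D : Fin 10 → ℤ,
        (if D = 0 then (19 / 17 : ℝ) ^ 20 else 1) ≤ shieldPotential α κ D) ∧
      ∀ D : Fin 10 → ℤ, ∑ k, ∑ l,
        shieldWeight ((19 / 17) ^ 19) ((19 / 17) ^ 20) (19 / 17) D k l *
          shieldPotential α κ (D + Pi.single k 1 - Pi.single l 1)
        ≤ ((10 : ℕ) : ℝ) ^ 2 * shieldPotential α κ D := by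
  -- The quotient of `green 0` by its value at a neighbour of the origin has to exceed about
  -- `50.6`, that is, `green 0 < 1.1335`. The margin is thin, so the coefficient of `green` is large.
  set G : ℝ := green (0 : Fin 10 → ℤ) with hG
  set g : ℝ := 1 + 5000 * (G - 10 / 9) with hg
  have hGN : ∀ i j : Fin 10, i ≠ j →
      1 + 5000 * green (Pi.single i 1 - Pi.single j 1 : Fin 10 → ℤ) = g := by
    intro i j hij
    have := green_single_sub_single_eq le_rfl hij
    push_cast at this
    rw [hg]
    linarith
  have hG1 : G ≤ 1.13305 := green_ten_le 0
  have hg1 : 1 ≤ g := by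
    rw [← hGN 0 1 (by decide)]
    have := green_nonneg (Pi.single 0 1 - Pi.single 1 1 : Fin 10 → ℤ)
    linarith
  have hpot0 : shieldPotential 5000 (20 * (19 / 17 - 1) * g) 0
      = 1 + 5000 * G - 20 * (19 / 17 - 1) * g := by simp [shieldPotential, origin, hG]
  have hmain : 90 * (19 / 17 : ℝ) ^ 20 * g
      ≤ (100 - 10 * (19 / 17) ^ 19) * (1 + 5000 * G - 20 * (19 / 17 - 1) * g) := by
    rw [hg]
    norm_num at hG1 ⊢
    nlinarith
  refine ⟨5000, 20 * (19 / 17 - 1) * g, fun D => ?_, sum_shieldWeight_mul_le (g := g) (by norm_num)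
    (by norm_num) (by nlinarith) hGN le_rfl ?_⟩
  · split_ifs with hD
    · subst hD
      -- `(100 - 10 a) h 0 ≥ 90 b g` with `g ≥ 1` and `100 - 10 a ≤ 90` gives `h 0 ≥ b`.
      rw [hpot0]
      norm_num at hmain ⊢
      nlinarith
    · have := green_nonneg D
      simp only [shieldPotential, origin, hD, if_false]
      linarith
  · rw [hpot0]
    linarith

end Potential

/-! ### Infinite shielded paths -/

section Shielded

variable {d : ℕ}

lemma shielded_iff {ω : Config d} {x : Fin d → ℤ} :
    Shielded ω x ↔ ω ∈ allState false (incident x) := by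
  simp only [Shielded, allState, Set.mem_ofPred_eq, mem_incident]

/-- The vertex reached from `x` after the first `m` steps of the infinite word `σ`. -/
def position {r : ℕ} (ι : Fin r → Fin d) (x : Fin d → ℤ) (σ : ℕ → Fin r) (m : ℕ) : Fin d → ℤ :=
  x + ∑ i ∈ Finset.range m, Pi.single (ι (σ i)) 1

lemma exists_shielded_of_shieldEdges {r : ℕ} {ι : Fin r → Fin d} (σ₀ : ℕ → Fin r) {ω : Config d}
    {n : ℕ} {x : Fin d → ℤ} {s : Fin n → Fin r} (h : ω ∈ allState false (shieldEdges ι n x s)) :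
    ∃ σ : ℕ → Fin r, ∀ m ≤ n, Shielded ω (position ι x σ m) := by
  induction n generalizing x with
  | zero =>
    refine ⟨σ₀, fun m hm => ?_⟩
    rw [Nat.le_zero.1 hm, shielded_iff]
    simpa [position, shieldEdges] using h
  | succ n ih =>
    obtain ⟨σ, hσ⟩ := ih (x := x + Pi.single (ι (s 0)) 1) (s := Fin.tail s)
      (fun e he => h e (by rw [shieldEdges]; exact Finset.mem_union_right _ he))
    refine ⟨fun i => Nat.casesOn i (s 0) σ, fun m hm => ?_⟩
    cases m with
    | zero =>
      rw [shielded_iff]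
      intro e he
      refine h e ?_
      rw [shieldEdges]
      exact Finset.mem_union_left _ (by simpa [position] using he)
    | succ m =>
      have := hσ m (by omega)
      have he : position ι x (fun i => Nat.casesOn i (s 0) σ) (m + 1)
          = position ι (x + Pi.single (ι (s 0)) 1) σ m := by
        rw [position, position, Finset.sum_range_succ']
        abel
      rwa [he]

/-- König's lemma for shielded oriented paths, by compactness of the space of infinite words. -/
lemma exists_shielded_word {r : ℕ} {ι : Fin r → Fin d} {ω : Config d} {x : Fin d → ℤ}
    (h : ∀ n, ∃ σ : ℕ → Fin r, ∀ m ≤ n, Shielded ω (position ι x σ m)) :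
    ∃ σ : ℕ → Fin r, ∀ m, Shielded ω (position ι x σ m) := by
  let C : ℕ → Set (ℕ → Fin r) := fun n => {σ | ∀ m ≤ n, Shielded ω (position ι x σ m)}
  have hcont : ∀ m, Continuous fun σ : ℕ → Fin r => position ι x σ m := by
    intro m
    refine continuous_const.add (continuous_finsetSum _ fun i _ => ?_)
    exact (continuous_of_discreteTopology (f := fun k : Fin r =>
      (Pi.single (ι k) 1 : Fin d → ℤ))).comp (continuous_apply i)
  have hclosed : ∀ n, IsClosed (C n) := by
    intro n
    have : C n = ⋂ m, ⋂ _ : m ≤ n, (fun σ => position ι x σ m) ⁻¹' {y | Shielded ω y} := by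
      ext σ; simp [C]
    rw [this]
    exact isClosed_iInter fun m => isClosed_iInter fun _ =>
      (isClosed_discrete _).preimage (hcont m)
  obtain ⟨σ, hσ⟩ := IsCompact.nonempty_iInter_of_sequence_nonempty_isCompact_isClosed C
    (fun n σ hσ m hm => hσ m (by omega)) h (hclosed 0).isCompact hclosed
  exact ⟨σ, fun m => Set.mem_iInter.1 hσ m m le_rfl⟩

lemma level_position {r : ℕ} (ι : Fin r → Fin d) (x : Fin d → ℤ) (σ : ℕ → Fin r) (m : ℕ) :
    level (position ι x σ m) = level x + m := by
  induction m with
  | zero => simp [position]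
  | succ m ih =>
    have : position ι x σ (m + 1) = position ι x σ m + Pi.single (ι (σ m)) 1 := by
      rw [position, position, Finset.sum_range_succ, add_assoc]
    rw [this, level_add_single, ih]
    push_cast
    ring

lemma hasInfiniteShieldedPath_of_word {r : ℕ} {ι : Fin r → Fin d} {ω : Config d} {x : Fin d → ℤ}
    {σ : ℕ → Fin r} (h : ∀ m, Shielded ω (position ι x σ m)) : HasInfiniteShieldedPath ω := by
  refine ⟨position ι x σ, fun m n hmn => ?_, fun n => ?_, h⟩
  · have := congrArg level hmn
    rw [level_position, level_position] at this
    omega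
  · rw [position, position, Finset.sum_range_succ, ← add_assoc]
    exact lattice_adj_add_single _ _

/-- The function `(1 - 2 / (2 d - 1)) ^ (2 d - 1)` increases with `d`, by Bernoulli's
inequality. -/
lemma one_div_pow_le (hd : 10 ≤ d) :
    (1 / (1 - 2 / (2 * (d : ℝ) - 1))) ^ (2 * d - 1) ≤ (19 / 17 : ℝ) ^ 19 := by
  have hd' : (10 : ℝ) ≤ d := by exact_mod_cast hd
  have hn : ((2 * d - 1 : ℕ) : ℝ) = 2 * d - 1 := by
    rw [Nat.cast_sub (by omega)]; push_cast; ring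
  set n : ℝ := 2 * (d : ℝ) - 1 with hndef
  have hn19 : (19 : ℝ) ≤ n := by linarith
  have hn0 : 0 < n := by linarith
  have h2n : 2 / n ≤ 2 / 19 := by gcongr
  have hbase : (0 : ℝ) < 1 - 2 / n := by linarith
  have hbern : (17 / 19 : ℝ) ≤ (1 - 2 / n) ^ (n / 19) := by
    have := one_add_mul_self_le_rpow_one_add (s := -(2 / n)) (by linarith) (p := n / 19)
      (by rw [le_div_iff₀ (by norm_num)]; linarith)
    have h1 : 1 + n / 19 * -(2 / n) = 17 / 19 := by field_simp; norm_num
    rw [h1] at this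
    simpa [sub_eq_add_neg] using this
  have hpow : (17 / 19 : ℝ) ^ 19 ≤ (1 - 2 / n) ^ (2 * d - 1) := by
    calc (17 / 19 : ℝ) ^ 19 ≤ ((1 - 2 / n) ^ (n / 19)) ^ 19 := by gcongr
      _ = (1 - 2 / n) ^ (2 * d - 1) := by
        rw [← Real.rpow_natCast, ← Real.rpow_mul hbase.le, ← Real.rpow_natCast, hn]
        congr 1
        push_cast
        field_simp
  rw [one_div, inv_pow, inv_le_comm₀ (by positivity) (by positivity)]
  refine le_trans (le_of_eq ?_) hpow
  norm_num

lemma bondMeasure_hasInfiniteShieldedPath_pos (hd : 10 ≤ d) {p : unitInterval}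
    (hp : (p : ℝ) = 2 / (2 * d - 1)) :
    0 < bondMeasure d p {ω | HasInfiniteShieldedPath ω} := by
  classical
  have hd' : (10 : ℝ) ≤ d := by exact_mod_cast hd
  let ι : Fin 10 → Fin d := Fin.castLE hd
  have hι : Function.Injective ι := Fin.castLE_injective hd
  have hpsmall : (p : ℝ) ≤ 2 / 19 := by rw [hp]; gcongr; linarith
  have hp0 : 0 ≤ (p : ℝ) := p.2.1
  have hq : stateProb p false = 1 - p := by simp [stateProb]
  set w : ℝ := 1 / (1 - p) with hw
  have hw1 : 1 ≤ w := by rw [hw, le_div_iff₀ (by linarith)]; linarith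
  have hwc : w ≤ 19 / 17 := by rw [hw, div_le_div_iff₀ (by linarith) (by norm_num)]; linarith
  have hwa : w ^ (2 * d - 1) ≤ (19 / 17) ^ 19 := by rw [hw, hp]; exact one_div_pow_le hd
  have hwb : w ^ (2 * d) ≤ (19 / 17) ^ 20 := by
    calc w ^ (2 * d) = w ^ (2 * d - 1) * w := by
          rw [← pow_succ]; congr 1; omega
      _ ≤ (19 / 17) ^ 19 * (19 / 17) := by gcongr
      _ = _ := by norm_num
  obtain ⟨α, κ, hT, hstep⟩ := exists_shieldPotential
  have key : ∀ n : ℕ, 1 ≤ shieldPotential α κ 0 * (bondMeasure d p).real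
      (⋃ s : Fin n → Fin 10, allState false (shieldEdges ι n 0 s)) := by
    intro n
    refine one_le_mul_measureReal_exists_allState p false (by rw [hq]; linarith) _ _ ?_
    rw [hq, ← one_div, ← hw]
    calc ∑ s, ∑ t, w ^ (shieldEdges ι n 0 s ∩ shieldEdges ι n 0 t).card
        ≤ ∑ s, ∑ t, pairWeight
            (shieldWeight ((19 / 17) ^ 19) ((19 / 17) ^ 20) (19 / 17))
            (fun D => if D = 0 then (19 / 17) ^ 20 else 1) n 0 s t :=
          Finset.sum_le_sum fun s _ => Finset.sum_le_sum fun t _ =>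
            pow_card_inter_shieldEdges_le hι hw1 hwa hwb hwc n 0 0 0
              ⟨fun _ => rfl, fun _ _ => rfl⟩ rfl s t
      _ ≤ (((10 : ℕ) : ℝ) ^ n) ^ 2 * shieldPotential α κ 0 := by
          refine sum_pairWeight_le (fun D k l => ?_) hT hstep n 0
          unfold shieldWeight
          split_ifs <;> positivity
      _ = _ := by simp [mul_comm]
  refine (measure_frequently_pos _ (fun n => MeasurableSet.iUnion fun s =>
    measurableSet_allState false _) key).trans_le (measure_mono fun ω hω => ?_)
  obtain ⟨σ, hσ⟩ := exists_shielded_word (ι := ι) (ω := ω) (x := 0) fun N => by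
    obtain ⟨n, hn, hωn⟩ := hω N
    obtain ⟨s, hs⟩ := Set.mem_iUnion.1 hωn
    obtain ⟨σ, hσ⟩ := exists_shielded_of_shieldEdges (fun _ => 0) hs
    exact ⟨σ, fun m hm => hσ m (hm.trans hn)⟩
  exact hasInfiniteShieldedPath_of_word hσ

lemma two_div_mem_Icc (hd : 10 ≤ d) : 2 / (2 * (d : ℝ) - 1) ∈ Set.Icc (0 : ℝ) 1 := by
  have hd' : (10 : ℝ) ≤ d := by exact_mod_cast hd
  exact ⟨div_nonneg (by norm_num) (by linarith), (div_le_one (by linarith)).2 (by linarith)⟩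

lemma le_pShield (hd : 10 ≤ d) : 2 / (2 * (d : ℝ) - 1) ≤ pShield d :=
  le_csSup ⟨1, fun _ hp => hp.1.2⟩
    ⟨two_div_mem_Icc hd, bondMeasure_hasInfiniteShieldedPath_pos hd rfl⟩

lemma pCrit_lt_two_div (hd : 10 ≤ d) : pCrit d < 2 / (2 * (d : ℝ) - 1) := by
  have hd' : (10 : ℝ) ≤ d := by exact_mod_cast hd
  refine (pCrit_le hd).trans_lt ?_
  rw [div_lt_div_iff₀ (by linarith) (by linarith)]
  linarith

/-- The open cluster of a shielded vertex is a singleton. -/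
lemma Shielded.cluster_eq {ω : Config d} {x : Fin d → ℤ} (h : Shielded ω x) :
    cluster ω x = {x} := by
  ext y
  rw [cluster, SimpleGraph.ConnectedComponent.mem_supp_iff, SimpleGraph.ConnectedComponent.eq,
    Set.mem_singleton_iff]
  constructor
  · intro hr
    obtain ⟨w⟩ := hr.symm
    cases w with
    | nil => rfl
    | cons hadj _ =>
      obtain ⟨hl, ho⟩ := hadj
      have := h ⟨s(x, _), hl⟩ (Sym2.mem_mk_left _ _)
      rw [this] at ho
      simp at ho
  · rintro rfl
    exact SimpleGraph.Reachable.refl _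

lemma HasInfiniteShieldedPath.hasInfiniteComponent {ω : Config d}
    (h : HasInfiniteShieldedPath ω) : HasInfiniteComponent (remainder ω) := by
  obtain ⟨γ, hinj, hadj, hsh⟩ := h
  let v : ℕ → {x | ¬ (cluster ω x).Infinite} := fun n =>
    ⟨γ n, by simp [(hsh n).cluster_eq]⟩
  have hreach : ∀ n, (remainder ω).Reachable (v 0) (v n) := by
    intro n
    induction n with
    | zero => exact SimpleGraph.Reachable.refl _
    | succ n ih => exact ih.trans (SimpleGraph.Adj.reachable (hadj n))
  refine ⟨(remainder ω).connectedComponentMk (v 0), ?_⟩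
  refine Set.infinite_of_injective_forall_mem (f := v)
    (fun m n hmn => hinj (congrArg Subtype.val hmn)) fun n => ?_
  rw [SimpleGraph.ConnectedComponent.mem_supp_iff, SimpleGraph.ConnectedComponent.eq]
  exact (hreach n).symm

end Shielded

end Percolation

theorem corollary2 (d : ℕ) (hd : 10 ≤ d) :
    Percolation.pCrit d < Percolation.pShield d ∧
      Percolation.pShield d ≤ Percolation.pFin d ∧
      ∃ p : unitInterval, Percolation.pCrit d < (p : ℝ) ∧
        0 < Percolation.bondMeasure d p
          {ω | Percolation.HasInfiniteComponent (Percolation.remainder ω)} := by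
  have hmono : ∀ p : unitInterval,
      0 < Percolation.bondMeasure d p {ω | Percolation.HasInfiniteShieldedPath ω} →
      0 < Percolation.bondMeasure d p
        {ω | Percolation.HasInfiniteComponent (Percolation.remainder ω)} := fun p hp =>
    hp.trans_le (measure_mono fun ω hω =>
      Percolation.HasInfiniteShieldedPath.hasInfiniteComponent hω)
  refine ⟨(Percolation.pCrit_lt_two_div hd).trans_le (Percolation.le_pShield hd),
    csSup_le_csSup ⟨1, fun _ hp => hp.1.2⟩
      ⟨_, Percolation.two_div_mem_Icc hd,
        Percolation.bondMeasure_hasInfiniteShieldedPath_pos hd rfl⟩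
      fun p ⟨hp, hpos⟩ => ⟨hp, hmono _ hpos⟩,
    ⟨_, Percolation.two_div_mem_Icc hd⟩, Percolation.pCrit_lt_two_div hd,
    hmono _ (Percolation.bondMeasure_hasInfiniteShieldedPath_pos hd rfl)⟩
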